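/- Notation. Let $d\in\mathbb N$, let $S^{d-1}\subset\mathbb R^d$ be the Euclidean unit sphere, and let $\|h\|$ be the operator norm of a matrix $h$ with respect to the Euclidean norm. For $\xi\in S^{d-1}$, a $\xi$-neighborhood is a relatively open set $W\subset S^{d-1}$ with $\xi\in W$. For $W\subset S^{d-1}$ open and $R>0$ put $C(W)=\{r\xi' : \xi'\in W,\ r>0\}$ and $C(W,R)=\{\eta\in C(W): |\eta|>R\}$. We use $\widehat f(\xi)=\int_{\mathbb R^d} f(x)e^{-2\pi i\langle x,\xi\rangle}\,dx$. A point $(x,\xi)\in\mathbb R^d\times S^{d-1}$ is a regular directed point of $u\in\mathcal S'(\mathbb R^d)$ if there are $\varphi\in C_c^\infty(\mathbb R^d)$, identically one in a neighborhood of $x$, and a $\xi$-neighborhood $W\subset S^{d-1}$ such that for every $N\in\mathbb N$ there is $C_N>0$ with $|\widehat{\varphi u}(\xi')|\le C_N(1+|\xi'|)^{-N}$ for all $\xi'\in C(W)$ (here $\widehat{\varphi u}$ is a smooth function, since $\varphi u$ has compact support). Let $H$ be a closed subgroup of $\mathrm{GL}(d,\mathbb R)$ with left Haar measure $dh$. For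 $\psi\in\mathcal S(\mathbb R^d)$, $u\in\mathcal S'(\mathbb R^d)$ and $(x,h)\in\mathbb R^d\times H$ let $[\pi(x,h)\psi](y)=|\det h|^{-1/2}\psi(h^{-1}(y-x))$ and $W_\psi u(x,h)=u\big(\overline{\pi(x,h)\psi}\big)$. For open $W\subset S^{d-1}$, $V\subset\mathbb R^d$ and $R>0$ let $$K_i(W,V,R)=\{h\in H: h^{-T}V\subset C(W,R)\},\qquad K_o(W,V,R)=\{h\in H: h^{-T}V\cap C(W,R)\neq\emptyset\}.$$ Statement. Assume that, for some $\xi_0\in\mathbb R^d$, the orbit $\mathcal O=\{h^T\xi_0: h\in H\}$ is open in $\mathbb R^d$ and the stabilizer $\{h\in H: h^T\xi_0=\xi_0\}$ is compact. Let $\mathcal V=(V_n)_{n\in\mathbb N}$ be a nonincreasing sequence of nonempty open sets such that each closure $\overline{V_n}$ is a compact subset of $\mathcal O$. Assume that for some $\xi_1\in\mathcal O\cap S^{d-1}$: (i) the dual action has the weak $\mathcal V$-cone approximation property at $\xi_1$: for all $\xi_1$-neighborhoods $W\subset S^{d-1}$ and all $R>0$ there are $n\in\mathbb N$, $R'>0$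 and a $\xi_1$-neighborhood $W'\subset S^{d-1}$ with $K_o(W',V_n,R')\subset K_i(W,V_n,R)$; (ii) there are $n\in\mathbb N$, a $\xi_1$-neighborhood $W_0\subset S^{d-1}$ and $R_0,\alpha_1,C>0$ such that $\|h^{-1}\|\le C\|h\|^{-\alpha_1}$ for all $h\in K_o(W_0,V_n,R_0)$. Let $(\psi_n)_{n\in\mathbb N}$ be any sequence of Schwartz functions that are admissible, i.e. $\int_H|\widehat{\psi_n}(h^T\xi)|^2\,dh=1$ for all $\xi\in\mathcal O$, and satisfy $\operatorname{supp}\widehat{\psi_n}\subset V_n$. Then there is $n_0\in\mathbb N$ such that for all $u\in\mathcal S'(\mathbb R^d)$ and all $(x,\xi)\in\mathbb R^d\times(\mathcal O\cap S^{d-1})$ the following are equivalent: 1. $(x,\xi)$ is a regular directed point of $u$; 2. there are a $\xi$-neighborhood $W\subset S^{d-1}$, some $R>0$, a neighborhood $U\subset\mathbb R^d$ of $x$ and some $n_1\in\mathbb N$ such that for all $n\ge n_1$: $$\forall N\in\mathbb N\ \exists C_N>0\ \forall y\in U\ \forall h\in K_o(W,V_n,R):\quad |W_{\psi_n}u(y,h)|\le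 C_N\|h\|^N;$$ 3. there are some $n\ge n_0$, a neighborhood $U\subset\mathbb R^d$ of $x$, some $R>0$ and a $\xi$-neighborhood $W\subset S^{d-1}$ such that $$\forall N\in\mathbb N\ \exists C_N>0\ \forall y\in U\ \forall h\in K_o(W,V_n,R):\quad |W_{\psi_n}u(y,h)|\le C_N\|h\|^N.$$ -/

import Mathlib

open Set MeasureTheory Topology
open scoped SchwartzMap FourierTransform ContDiff ComplexConjugate

namespace WaveletWF

noncomputable section

/-- `ℝ^d` with the Euclidean norm. -/
abbrev Rd (d : ℕ) : Type := EuclideanSpace ℝ (Fin d)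

/-- The unit sphere `S^{d-1}` with its relative topology. -/
abbrev Sph (d : ℕ) : Type := Metric.sphere (0 : Rd d) 1

/-- The invertible linear map `x ↦ h x` of `ℝ^d` given by `h ∈ GL(d, ℝ)`. -/
def linEquiv {d : ℕ} (h : GL (Fin d) ℝ) : Rd d ≃L[ℝ] Rd d :=
  ContinuousLinearEquiv.unitsEquiv ℝ (Rd d)
    (Units.map (Matrix.toEuclideanCLM (n := Fin d) (𝕜 := ℝ)).toMonoidHom h)

theorem linEquiv_apply {d : ℕ} (h : GL (Fin d) ℝ) (x : Rd d) :
    linEquiv h x = Matrix.toEuclideanCLM (n := Fin d) (𝕜 := ℝ) (h : Matrix (Fin d) (Fin d) ℝ) x :=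
  rfl

/-- The operator norm `‖h‖` of the matrix `h` with respect to the Euclidean norm. -/
def opNorm {d : ℕ} (h : GL (Fin d) ℝ) : ℝ :=
  ‖Matrix.toEuclideanCLM (n := Fin d) (𝕜 := ℝ) (h : Matrix (Fin d) (Fin d) ℝ)‖

/-- The dual action `(ξ, h) ↦ h^T ξ`. -/
def dualAct {d : ℕ} (h : GL (Fin d) ℝ) (ξ : Rd d) : Rd d :=
  Matrix.toEuclideanCLM (n := Fin d) (𝕜 := ℝ) (h : Matrix (Fin d) (Fin d) ℝ).transpose ξ

/-- The orbit `H^T ξ₀ = {h^T ξ₀ | h ∈ H}` of the dual action. -/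
def dualOrbit {d : ℕ} (H : Subgroup (GL (Fin d) ℝ)) (ξ₀ : Rd d) : Set (Rd d) :=
  {η | ∃ h ∈ H, η = dualAct h ξ₀}

/-- The stabilizer `{h ∈ H | h^T ξ₀ = ξ₀}` of the dual action. -/
def dualStabilizer {d : ℕ} (H : Subgroup (GL (Fin d) ℝ)) (ξ₀ : Rd d) : Set H :=
  {h | dualAct (h : GL (Fin d) ℝ) ξ₀ = ξ₀}

/-- The cone `C(W) = {r ξ' | ξ' ∈ W, r > 0}` over `W ⊆ S^{d-1}`. -/
def cone {d : ℕ} (W : Set (Sph d)) : Set (Rd d) :=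
  {η | ∃ w ∈ W, ∃ r : ℝ, 0 < r ∧ η = r • (w : Rd d)}

/-- The truncated cone `C(W, R)`: the points of `C(W)` outside the closed ball of radius `R`. -/
def coneAbove {d : ℕ} (W : Set (Sph d)) (R : ℝ) : Set (Rd d) :=
  cone W \ Metric.closedBall 0 R

/-- The inner set `K_i(W, V, R) = {h ∈ H | h^{-T} V ⊆ C(W, R)}`. -/
def Ki {d : ℕ} (H : Subgroup (GL (Fin d) ℝ)) (W : Set (Sph d)) (V : Set (Rd d)) (R : ℝ) : Set H :=
  {h | dualAct (h : GL (Fin d) ℝ)⁻¹ '' V ⊆ coneAbove W R}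

/-- The outer set `K_o(W, V, R) = {h ∈ H | h^{-T} V ∩ C(W, R) ≠ ∅}`. -/
def Ko {d : ℕ} (H : Subgroup (GL (Fin d) ℝ)) (W : Set (Sph d)) (V : Set (Rd d)) (R : ℝ) : Set H :=
  {h | (dualAct (h : GL (Fin d) ℝ)⁻¹ '' V ∩ coneAbove W R).Nonempty}

/-- `∅ ≠ V ⋐ O`: `V` is nonempty and open, and its closure is a compact subset of `O`. -/
def CompactlyInside {d : ℕ} (V O : Set (Rd d)) : Prop :=
  V.Nonempty ∧ IsOpen V ∧ IsCompact (closure V) ∧ closure V ⊆ O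

/-- The weak `𝒱`-cone approximation property of the dual action at `ξ`. -/
def WeakConeApprox {d : ℕ} (H : Subgroup (GL (Fin d) ℝ)) (V : ℕ → Set (Rd d)) (ξ : Sph d) : Prop :=
  ∀ W : Set (Sph d), IsOpen W → ξ ∈ W → ∀ R : ℝ, 0 < R →
    ∃ n : ℕ, ∃ R' : ℝ, 0 < R' ∧ ∃ W' : Set (Sph d), IsOpen W' ∧ ξ ∈ W' ∧
      Ko H W' (V n) R' ⊆ Ki H W (V n) R

/-- The estimate `‖h⁻¹‖ ≤ C ‖h‖^{-α₁}` on some set `K_o(W₀, V, R₀)`, where `W₀` is a neighborhood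
of `ξ` in the sphere. -/
def InverseNormEstimate {d : ℕ} (H : Subgroup (GL (Fin d) ℝ)) (V : Set (Rd d)) (ξ : Sph d) : Prop :=
  ∃ W₀ : Set (Sph d), IsOpen W₀ ∧ ξ ∈ W₀ ∧ ∃ R₀ : ℝ, 0 < R₀ ∧
    ∃ α₁ : ℝ, 0 < α₁ ∧ ∃ C : ℝ, 0 < C ∧ ∀ h ∈ Ko H W₀ V R₀,
      opNorm (h : GL (Fin d) ℝ)⁻¹ ≤ C * opNorm (h : GL (Fin d) ℝ) ^ (-α₁)

/-- The quasi-regular representation on Schwartz functions: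
`[π(x, h) f](y) = |det h|^{-1/2} f(h⁻¹ (y - x))`. -/
def quasiRegular {d : ℕ} (x : Rd d) (h : GL (Fin d) ℝ) (f : 𝓢(Rd d, ℂ)) : 𝓢(Rd d, ℂ) :=
  (|(h : Matrix (Fin d) (Fin d) ℝ).det| ^ (-(1 / 2) : ℝ)) •
    SchwartzMap.compSubConstCLM ℂ x
      (SchwartzMap.compCLMOfContinuousLinearEquiv ℂ (linEquiv h⁻¹) f)

theorem quasiRegular_apply {d : ℕ} (x : Rd d) (h : GL (Fin d) ℝ) (f : 𝓢(Rd d, ℂ)) (y : Rd d) :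
    quasiRegular x h f y =
      ((|(h : Matrix (Fin d) (Fin d) ℝ).det| ^ (-(1 / 2) : ℝ) : ℝ) : ℂ) *
        f (linEquiv h⁻¹ (y - x)) := by
  simp [quasiRegular]

/-- Complex conjugation of a Schwartz function. -/
def conjSchwartz {d : ℕ} (f : 𝓢(Rd d, ℂ)) : 𝓢(Rd d, ℂ) :=
  SchwartzMap.postcompCLM (𝕜 := ℝ) (Complex.conjCLE : ℂ →L[ℝ] ℂ) f

theorem conjSchwartz_apply {d : ℕ} (f : 𝓢(Rd d, ℂ)) (y : Rd d) :
    conjSchwartz f y = conj (f y) := rfl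

/-- The wavelet transform `W_ψ u(x, h) = ⟨u ∣ π(x, h) ψ⟩ = u(conj (π(x, h) ψ))` of a tempered
distribution `u`. -/
def waveletTransform {d : ℕ} (ψ : 𝓢(Rd d, ℂ)) (u : 𝓢'(Rd d, ℂ)) (x : Rd d) (h : GL (Fin d) ℝ) : ℂ :=
  u (conjSchwartz (quasiRegular x h ψ))

/-- `ψ` is admissible for the orbit `O` with respect to the left Haar measure `μ` on `H`:
`∫_H |ψ̂(h^T ξ)|² dh = 1` for all `ξ ∈ O`. -/
def Admissible {d : ℕ} (H : Subgroup (GL (Fin d) ℝ)) [MeasurableSpace H] (μ : Measure H)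
    (O : Set (Rd d)) (ψ : 𝓢(Rd d, ℂ)) : Prop :=
  ∀ ξ ∈ O, ∫ h : H, ‖(𝓕 ψ) (dualAct (h : GL (Fin d) ℝ) ξ)‖ ^ 2 ∂μ = 1

/-- `(x, ξ)` is a regular directed point of the tempered distribution `u`: for some
`φ ∈ C_c^∞(ℝ^d)` that is identically one near `x`, the Fourier transform of the compactly supported
distribution `φ u`, which is (integration against) a smooth function `g` of moderate growth,
decays rapidly on the cone over some neighborhood `W` of `ξ`. -/
def IsRegularDirectedPoint {d : ℕ} (u : 𝓢'(Rd d, ℂ)) (x : Rd d) (ξ : Sph d) : Prop :=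
  ∃ φ : Rd d → ℂ, ContDiff ℝ ∞ φ ∧ HasCompactSupport φ ∧ (∀ᶠ y in 𝓝 x, φ y = 1) ∧
    ∃ (g : Rd d → ℂ) (hg : g.HasTemperateGrowth),
      𝓕 (TemperedDistribution.smulLeftCLM ℂ φ u) = hg.toTemperedDistribution ∧
      ∃ W : Set (Sph d), IsOpen W ∧ ξ ∈ W ∧
        ∀ N : ℕ, ∃ C : ℝ, 0 < C ∧ ∀ η ∈ cone W, ‖g η‖ ≤ C * ((1 + ‖η‖) ^ N)⁻¹

/-- Rapid decay of wavelet coefficients: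
`∀ N, ∃ C_N > 0, ∀ y ∈ U, ∀ h ∈ K, |W_ψ u(y, h)| ≤ C_N ‖h‖^N`. -/
def RapidDecayOn {d : ℕ} {H : Subgroup (GL (Fin d) ℝ)} (ψ : 𝓢(Rd d, ℂ)) (u : 𝓢'(Rd d, ℂ))
    (U : Set (Rd d)) (K : Set H) : Prop :=
  ∀ N : ℕ, ∃ C : ℝ, 0 < C ∧ ∀ y ∈ U, ∀ h ∈ K,
    ‖waveletTransform ψ u y (h : GL (Fin d) ℝ)‖ ≤ C * opNorm (h : GL (Fin d) ℝ) ^ N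

end

end WaveletWF

/-! Write K for an outer set K_o. On K, `‖h‖` is bounded and `‖h⁻¹‖` is at most polynomial in
`‖h‖⁻¹` (`Tame`). Every loss of powers of `‖h⁻¹‖`, from determinants, dilations or translations, can
then be paid for by proving the decay in `‖h‖` with a larger exponent (`pow_mul_pow_le`). Both
hypotheses at ξ₁ move to any other unit vector of the orbit by left translation in `H`
(`exists_tame_Ko`, `WeakConeApprox.transport`).

From a regular directed point to decay: split the wavelet F = π(y,h)ψ̄ into φF and (1-φ)F. The
pairing of u with φF is the integral of the Fourier transform of φu against 𝓕⁻¹F. By cone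
approximation 𝓕⁻¹F lives on a cone of rapid decay, at frequencies of size at least c/‖h‖
(`exists_norm_integral_fourierInv_quasiRegular_le`). In the coordinates of ψ the second part is a
Schwartz function cut off to ‖hw‖ ≥ ε, hence smaller than any power of ‖h‖ (`exists_norm_away_le`).

Conversely, no reconstruction integral over `H` is needed; one h per frequency suffices.
Admissibility and the support condition give p ∈ V_n in the orbit with ψ̂(p) ≠ 0. A large frequency
η in the cone is moved to p by some h, which then lies in K. The Fourier transform of φu at η is u
applied to a modulation of φ, whose spectrum is concentrated near -η. Near that frequency, dividing
by the Fourier transform of π(0,h)ψ̄ (`exists_fourier_mul_eq_bump`) writes this test function as a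
superposition over y of π(y,h)ψ̄, weighted by `localKernel`. The kernel is negligible for y far from
x, and near x the wavelet coefficients decay. The spectral remainder is cut off away from -η, so it
is again smaller than any power of ‖h‖ (`exists_norm_frequency_away_le`). Finally a high power of
‖h‖ is a high power of (1+‖η‖)⁻¹, by tameness and ‖η‖ ≤ ‖h⁻¹‖‖p‖.

The analytic tool behind both the formula for the Fourier transform of φu and the superposition is
`clm_mul_fourier_eq_integral`, which moves a distribution under a Fourier integral. -/

namespace WaveletWF

/-! ### Schwartz seminorm estimates, uniform in families -/

section Seminorms

variable {d : ℕ}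

/-- A continuous linear map from Schwartz functions to a normed space is bounded by finitely many
Schwartz seminorms. -/
theorem exists_seminorm_bound {N : Type*} [NormedAddCommGroup N] [NormedSpace ℂ N]
    (T : 𝓢(Rd d, ℂ) →L[ℂ] N) :
    ∃ (s : Finset (ℕ × ℕ)) (C : ℝ), 0 ≤ C ∧
      ∀ f, ‖T f‖ ≤ C * s.sup (schwartzSeminormFamily ℂ (Rd d) ℂ) f := by
  have hc : Continuous ((normSeminorm ℂ N).comp (T : 𝓢(Rd d, ℂ) →ₗ[ℂ] N)) :=
    continuous_norm.comp T.continuous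
  obtain ⟨s, C, -, h⟩ :=
    Seminorm.bound_of_continuous (schwartz_withSeminorms ℂ (Rd d) ℂ) _ hc
  exact ⟨s, C, C.2, fun f => h f⟩

theorem sup_seminorm_le {ι : Type*} (s : Set ι) (F : ι → 𝓢(Rd d, ℂ)) (w : ι → ℝ)
    (hw : ∀ i ∈ s, 0 ≤ w i)
    (h : ∀ k l : ℕ, ∃ C : ℝ, ∀ i ∈ s, SchwartzMap.seminorm ℂ k l (F i) ≤ C * w i)
    (t : Finset (ℕ × ℕ)) :
    ∃ C : ℝ, 0 ≤ C ∧ ∀ i ∈ s, t.sup (schwartzSeminormFamily ℂ (Rd d) ℂ) (F i) ≤ C * w i := by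
  choose c hc using h
  refine ⟨∑ p ∈ t, |c p.1 p.2|, by positivity, fun i hi => ?_⟩
  refine Seminorm.finset_sup_apply_le ?_ fun p hp => ?_
  · exact mul_nonneg (by positivity) (hw i hi)
  · refine (hc p.1 p.2 i hi).trans (mul_le_mul_of_nonneg_right ?_ (hw i hi))
    exact (le_abs_self _).trans
      (Finset.single_le_sum (f := fun p : ℕ × ℕ => |c p.1 p.2|) (fun _ _ => abs_nonneg _) hp)

/-- Since `T` sees only finitely many seminorms, a constant that depends on `k` and `l` in the
hypothesis still yields a single constant. -/
theorem norm_le_of_seminorm_le {N ι : Type*} [NormedAddCommGroup N] [NormedSpace ℂ N]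
    (T : 𝓢(Rd d, ℂ) →L[ℂ] N) (s : Set ι) (F : ι → 𝓢(Rd d, ℂ)) (w : ι → ℝ)
    (hw : ∀ i ∈ s, 0 ≤ w i)
    (h : ∀ k l : ℕ, ∃ C : ℝ, ∀ i ∈ s, SchwartzMap.seminorm ℂ k l (F i) ≤ C * w i) :
    ∃ C : ℝ, 0 ≤ C ∧ ∀ i ∈ s, ‖T (F i)‖ ≤ C * w i := by
  obtain ⟨t, C, hC, hT⟩ := exists_seminorm_bound T
  obtain ⟨c, hc0, hc⟩ := sup_seminorm_le s F w hw h t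
  refine ⟨C * c, by positivity, fun i hi => (hT _).trans ?_⟩
  rw [mul_assoc]
  exact mul_le_mul_of_nonneg_left (hc i hi) hC

/-- Here the exponent may also vary with the seminorm; because the weight is at least one, the sum
of the finitely many exponents serves for all. -/
theorem norm_le_pow_of_seminorm_le {N ι : Type*} [NormedAddCommGroup N] [NormedSpace ℂ N]
    (T : 𝓢(Rd d, ℂ) →L[ℂ] N) (s : Set ι) (F : ι → 𝓢(Rd d, ℂ)) (w : ι → ℝ)
    (hw : ∀ i ∈ s, 1 ≤ w i)
    (h : ∀ k l : ℕ, ∃ (C : ℝ) (m : ℕ), ∀ i ∈ s, SchwartzMap.seminorm ℂ k l (F i) ≤ C * w i ^ m) :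
    ∃ (C : ℝ) (m : ℕ), 0 ≤ C ∧ ∀ i ∈ s, ‖T (F i)‖ ≤ C * w i ^ m := by
  obtain ⟨t, C, hC, hT⟩ := exists_seminorm_bound T
  choose c m hc using h
  refine ⟨C * ∑ p ∈ t, |c p.1 p.2|, ∑ p ∈ t, m p.1 p.2, by positivity,
    fun i hi => (hT _).trans ?_⟩
  have hi1 := hw i hi
  have hi0 : 0 ≤ w i := zero_le_one.trans hi1
  rw [mul_assoc]
  refine mul_le_mul_of_nonneg_left (Seminorm.finset_sup_apply_le (by positivity) fun p hp => ?_) hC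
  refine (hc p.1 p.2 i hi).trans ?_
  refine mul_le_mul ?_ (pow_le_pow_right₀ hi1 ?_) (by positivity) (by positivity)
  · exact (le_abs_self _).trans
      (Finset.single_le_sum (f := fun p : ℕ × ℕ => |c p.1 p.2|) (fun _ _ => abs_nonneg _) hp)
  · exact Finset.single_le_sum (f := fun p : ℕ × ℕ => m p.1 p.2) (fun _ _ => Nat.zero_le _) hp

/-- The seminorms of a product with a function whose derivatives grow polynomially. -/
theorem seminorm_mul_le (k l m : ℕ) (a : Rd d → ℂ) (f F : 𝓢(Rd d, ℂ)) {B : ℝ}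
    (ha : ContDiff ℝ ∞ a) (hB : 0 ≤ B)
    (hab : ∀ j ≤ l, ∀ ζ, ‖iteratedFDeriv ℝ j a ζ‖ ≤ B * (1 + ‖ζ‖) ^ m)
    (hF : ∀ ζ, F ζ = a ζ * f ζ) :
    SchwartzMap.seminorm ℂ k l F ≤ 2 ^ l * 2 ^ (k + m) *
      (Finset.Iic (k + m, l)).sup (schwartzSeminormFamily ℂ (Rd d) ℂ) f * B := by
  set q := (Finset.Iic (k + m, l)).sup (schwartzSeminormFamily ℂ (Rd d) ℂ) f with hq
  have hq0 : 0 ≤ q := apply_nonneg _ _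
  refine SchwartzMap.seminorm_le_bound ℂ k l F (by positivity) fun ζ => ?_
  have hFa : (F : Rd d → ℂ) = fun ζ => a ζ * f ζ := funext hF
  rw [hFa]
  have h1 := norm_iteratedFDeriv_mul_le (𝕜 := ℝ) (n := l) (N := (l : ℕ∞))
    (ha.of_le (mod_cast le_top)) (f.smooth l) ζ le_rfl
  refine (mul_le_mul_of_nonneg_left h1 (by positivity)).trans ?_
  rw [Finset.mul_sum]
  have h2 : ∀ i ∈ Finset.range (l + 1), ‖ζ‖ ^ k * ((l.choose i : ℝ) *
      ‖iteratedFDeriv ℝ i a ζ‖ * ‖iteratedFDeriv ℝ (l - i) f ζ‖) ≤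
      l.choose i * (2 ^ (k + m) * q * B) := by
    intro i hi
    have hi' : i ≤ l := Nat.lt_succ_iff.mp (Finset.mem_range.mp hi)
    have h3 := SchwartzMap.one_add_le_sup_seminorm_apply (𝕜 := ℂ) (m := (k + m, l)) le_rfl
      (Nat.sub_le l i) f ζ
    have h3' : (1 + ‖ζ‖) ^ (k + m) * ‖iteratedFDeriv ℝ (l - i) f ζ‖ ≤ 2 ^ (k + m) * q := h3
    have hk : ‖ζ‖ ^ k ≤ (1 + ‖ζ‖) ^ k := pow_le_pow_left₀ (norm_nonneg _) (by linarith) _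
    calc _ ≤ (1 + ‖ζ‖) ^ k * ((l.choose i : ℝ) *
          (B * (1 + ‖ζ‖) ^ m) * ‖iteratedFDeriv ℝ (l - i) f ζ‖) := by
          gcongr
          exact hab i hi' ζ
      _ = l.choose i * (((1 + ‖ζ‖) ^ (k + m) * ‖iteratedFDeriv ℝ (l - i) f ζ‖) * B) := by
          rw [pow_add]; ring
      _ ≤ _ := by gcongr
  refine (Finset.sum_le_sum h2).trans (le_of_eq ?_)
  rw [← Finset.sum_mul, ← Nat.cast_sum, Nat.sum_range_choose]
  push_cast; ring

/-- The seminorms of the composition with an invertible affine map. -/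
theorem seminorm_comp_affine_le (k l : ℕ) (A : Rd d ≃L[ℝ] Rd d) (b : Rd d) (f F : 𝓢(Rd d, ℂ))
    (hF : ∀ z, F z = f (A (z - b))) :
    SchwartzMap.seminorm ℂ k l F ≤ ‖(A : Rd d →L[ℝ] Rd d)‖ ^ l *
      (‖(A.symm : Rd d →L[ℝ] Rd d)‖ + ‖b‖) ^ k * (2 ^ k *
      (Finset.Iic (k, l)).sup (schwartzSeminormFamily ℂ (Rd d) ℂ) f) := by
  refine SchwartzMap.seminorm_le_bound ℂ k l F (by positivity) fun z => ?_
  have hFa : (F : Rd d → ℂ) = fun z => (f ∘ (A : Rd d →L[ℝ] Rd d)) (z - b) := funext hF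
  rw [hFa, iteratedFDeriv_comp_sub,
    ContinuousLinearMap.iteratedFDeriv_comp_right _ (f.smooth l) _ le_rfl]
  have h1 := ContinuousMultilinearMap.norm_compContinuousLinearMap_le
    (iteratedFDeriv ℝ l f ((A : Rd d →L[ℝ] Rd d) (z - b)))
    (fun _ : Fin l => (A : Rd d →L[ℝ] Rd d))
  rw [Finset.prod_const, Finset.card_univ, Fintype.card_fin] at h1
  set w := (A : Rd d →L[ℝ] Rd d) (z - b) with hw
  have hz : z = (A.symm : Rd d →L[ℝ] Rd d) w + b := by simp [hw]
  have hzn : ‖z‖ ≤ (‖(A.symm : Rd d →L[ℝ] Rd d)‖ + ‖b‖) * (1 + ‖w‖) := by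
    calc ‖z‖ = ‖(A.symm : Rd d →L[ℝ] Rd d) w + b‖ := by rw [← hz]
      _ ≤ ‖(A.symm : Rd d →L[ℝ] Rd d)‖ * ‖w‖ + ‖b‖ :=
        (norm_add_le _ _).trans (by gcongr; exact ContinuousLinearMap.le_opNorm _ _)
      _ ≤ _ := by nlinarith [norm_nonneg (A.symm : Rd d →L[ℝ] Rd d), norm_nonneg b, norm_nonneg w,
        mul_nonneg (norm_nonneg b) (norm_nonneg w)]
  have h3 : (1 + ‖w‖) ^ k * ‖iteratedFDeriv ℝ l f w‖ ≤ 2 ^ k *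
      (Finset.Iic (k, l)).sup (schwartzSeminormFamily ℂ (Rd d) ℂ) f :=
    SchwartzMap.one_add_le_sup_seminorm_apply (𝕜 := ℂ) (m := (k, l)) le_rfl le_rfl f w
  calc _ ≤ ((‖(A.symm : Rd d →L[ℝ] Rd d)‖ + ‖b‖) * (1 + ‖w‖)) ^ k *
        (‖iteratedFDeriv ℝ l f w‖ * ‖(A : Rd d →L[ℝ] Rd d)‖ ^ l) := by gcongr
    _ = ‖(A : Rd d →L[ℝ] Rd d)‖ ^ l * (‖(A.symm : Rd d →L[ℝ] Rd d)‖ + ‖b‖) ^ k *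
        ((1 + ‖w‖) ^ k * ‖iteratedFDeriv ℝ l f w‖) := by rw [mul_pow]; ring
    _ ≤ _ := by gcongr

end Seminorms

/-! ### Modulations, and smoothness of `y ↦ T (modS y f)` -/

section Modulation

variable {d : ℕ}

/-- The character `ζ ↦ e^{-2πi⟨y, ζ⟩}`. -/
noncomputable def chr (y ζ : Rd d) : ℂ := Complex.exp (-(2 * Real.pi * Complex.I) * (inner ℝ y ζ : ℝ))

theorem chr_eq_fourierChar (y ζ : Rd d) :
    chr y ζ = (Real.fourierChar (-inner ℝ y ζ) : ℂ) := by
  rw [Real.fourierChar_apply, chr]; congr 1; push_cast; ring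

theorem norm_chr (y ζ : Rd d) : ‖chr y ζ‖ = 1 := by
  rw [chr_eq_fourierChar]; exact Circle.norm_coe _

theorem chr_add_left (y y' ζ : Rd d) : chr (y + y') ζ = chr y ζ * chr y' ζ := by
  simp only [chr, inner_add_left, ← Complex.exp_add]; congr 1; push_cast; ring

theorem norm_iteratedFDeriv_comp_inner_le {q : ℝ → ℂ} (hq : ContDiff ℝ ∞ q) (v ζ : Rd d) (j : ℕ) :
    ‖iteratedFDeriv ℝ j (fun ζ => q (inner ℝ v ζ)) ζ‖ ≤
      ‖v‖ ^ j * ‖iteratedDeriv j q (inner ℝ v ζ)‖ := by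
  have h : (fun ζ => q (inner ℝ v ζ)) = q ∘ (innerSL ℝ v) := rfl
  rw [h, ContinuousLinearMap.iteratedFDeriv_comp_right (n := ∞) _ hq _ (mod_cast le_top)]
  refine (ContinuousMultilinearMap.norm_compContinuousLinearMap_le _ _).trans (le_of_eq ?_)
  rw [Finset.prod_const, Finset.card_univ, Fintype.card_fin, innerSL_apply_norm,
    norm_iteratedFDeriv_eq_norm_iteratedDeriv, mul_comm]
  rfl

theorem hasDerivAt_cexp_mul_ofReal (c : ℂ) (s : ℝ) :
    HasDerivAt (fun s : ℝ => Complex.exp (c * s)) (c * Complex.exp (c * s)) s := by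
  have h := ((hasDerivAt_id (s : ℂ)).const_mul c).cexp.comp_ofReal
  simpa [mul_comm] using h

theorem iteratedDeriv_cexp_mul_ofReal (c : ℂ) (j : ℕ) :
    iteratedDeriv j (fun s : ℝ => Complex.exp (c * s)) =
      fun s : ℝ => c ^ j * Complex.exp (c * s) := by
  induction j with
  | zero => simp
  | succ j ih =>
    rw [iteratedDeriv_succ, ih]
    funext s
    rw [((hasDerivAt_cexp_mul_ofReal c s).const_mul (c ^ j)).deriv]
    ring

theorem contDiff_cexp_mul_ofReal (c : ℂ) :
    ContDiff ℝ ∞ (fun s : ℝ => Complex.exp (c * s)) :=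
  (contDiff_const.mul Complex.ofRealCLM.contDiff).cexp

theorem norm_neg_two_pi_I : ‖-(2 * Real.pi * Complex.I)‖ = 2 * Real.pi := by
  simp [abs_of_pos Real.pi_pos]

theorem norm_cexp_neg_two_pi_I (s : ℝ) :
    ‖Complex.exp (-(2 * Real.pi * Complex.I) * s)‖ = 1 := by
  have : -(2 * Real.pi * Complex.I) * s = ((-(2 * Real.pi * s) : ℝ) : ℂ) * Complex.I := by
    push_cast; ring
  rw [this, Complex.norm_exp_ofReal_mul_I]

theorem contDiff_chr (y : Rd d) : ContDiff ℝ ∞ (chr y) := by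
  unfold chr
  exact (contDiff_cexp_mul_ofReal _).comp (innerSL ℝ y).contDiff

theorem norm_iteratedFDeriv_chr_le (y ζ : Rd d) (j : ℕ) :
    ‖iteratedFDeriv ℝ j (chr y) ζ‖ ≤ (2 * Real.pi * ‖y‖) ^ j := by
  refine (norm_iteratedFDeriv_comp_inner_le (contDiff_cexp_mul_ofReal _) y ζ j).trans ?_
  rw [iteratedDeriv_cexp_mul_ofReal, norm_mul, norm_pow, norm_neg_two_pi_I,
    norm_cexp_neg_two_pi_I, mul_one, mul_pow _ ‖y‖, mul_comm]

theorem hasTemperateGrowth_chr (y : Rd d) : (chr y).HasTemperateGrowth :=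
  ⟨contDiff_chr y, fun n => ⟨0, (2 * Real.pi * ‖y‖) ^ n, fun ζ => by
    simpa using norm_iteratedFDeriv_chr_le y ζ n⟩⟩

/-- Multiplication of a Schwartz function by `e^{-2πi⟨y, ·⟩}`. -/
noncomputable def modS (y : Rd d) : 𝓢(Rd d, ℂ) →L[ℂ] 𝓢(Rd d, ℂ) := SchwartzMap.smulLeftCLM ℂ (chr y)

theorem modS_apply (y : Rd d) (f : 𝓢(Rd d, ℂ)) (ζ : Rd d) : modS y f ζ = chr y ζ * f ζ := by
  rw [modS, SchwartzMap.smulLeftCLM_apply_apply (hasTemperateGrowth_chr y), smul_eq_mul]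

theorem modS_add (y y' : Rd d) (f : 𝓢(Rd d, ℂ)) : modS (y + y') f = modS y (modS y' f) := by
  ext ζ; simp only [modS_apply, chr_add_left, mul_assoc]

theorem hasTemperateGrowth_lin (v : Rd d) :
    (fun ζ : Rd d => -(2 * Real.pi * Complex.I) * ((inner ℝ v ζ : ℝ) : ℂ)).HasTemperateGrowth := by
  have h : (fun ζ : Rd d => ((inner ℝ v ζ : ℝ) : ℂ)).HasTemperateGrowth :=
    (Complex.ofRealCLM ∘L innerSL ℝ v).hasTemperateGrowth
  fun_prop

/-- Multiplication of a Schwartz function by the linear function `-2πi⟨v, ·⟩`. -/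
noncomputable def linS (v : Rd d) : 𝓢(Rd d, ℂ) →L[ℂ] 𝓢(Rd d, ℂ) :=
  SchwartzMap.smulLeftCLM ℂ (fun ζ : Rd d => -(2 * Real.pi * Complex.I) * ((inner ℝ v ζ : ℝ) : ℂ))

theorem linS_apply (v : Rd d) (f : 𝓢(Rd d, ℂ)) (ζ : Rd d) :
    linS v f ζ = -(2 * Real.pi * Complex.I) * ((inner ℝ v ζ : ℝ) : ℂ) * f ζ := by
  rw [linS, SchwartzMap.smulLeftCLM_apply_apply (hasTemperateGrowth_lin v), smul_eq_mul]

theorem norm_exp_sub_one_sub_le (s : ℝ) :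
    ‖Complex.exp (-(2 * Real.pi * Complex.I) * s) - 1 - -(2 * Real.pi * Complex.I) * s‖ ≤
      3 * (2 * Real.pi * |s|) ^ 2 := by
  set z := -(2 * Real.pi * Complex.I) * s with hz
  have hzn : ‖z‖ = 2 * Real.pi * |s| := by
    rw [hz, norm_mul, norm_neg_two_pi_I, Complex.norm_real, Real.norm_eq_abs]
  rw [← hzn]
  rcases le_total ‖z‖ 1 with h | h
  · refine (Complex.norm_exp_sub_one_sub_id_le h).trans ?_
    nlinarith [sq_nonneg ‖z‖]
  · calc _ ≤ ‖Complex.exp z‖ + ‖(1 : ℂ)‖ + ‖z‖ :=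
        (norm_sub_le _ _).trans (by gcongr; exact norm_sub_le _ _)
      _ ≤ _ := by rw [hz, norm_cexp_neg_two_pi_I, ← hz, norm_one]; nlinarith

/-- The Taylor remainder is quadratic in `v` in every derivative, which makes difference quotients
of modulations converge in the Schwartz topology. Orders 0 and 1 are Taylor estimates; from order 2
on the affine part disappears and `‖v‖ ^ j ≤ ‖v‖ ^ 2`. -/
theorem norm_iteratedFDeriv_chr_remainder_le {v : Rd d} (hv : ‖v‖ ≤ 1) (ζ : Rd d) (l : ℕ) :
    ∀ j ≤ l, ‖iteratedFDeriv ℝ j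
      (fun ζ => chr v ζ - 1 - -(2 * Real.pi * Complex.I) * (inner ℝ v ζ : ℝ)) ζ‖ ≤
      3 * (2 * Real.pi) ^ (l + 2) * ‖v‖ ^ 2 * (1 + ‖ζ‖) ^ 2 := by
  intro j hj
  set c := -(2 * Real.pi * Complex.I) with hc
  set q : ℝ → ℂ := fun s => Complex.exp (c * s) - 1 - c * s with hq
  have hcl : ∀ s : ℝ, HasDerivAt (fun s : ℝ => c * (s : ℂ)) c s := fun s => by
    simpa using ((hasDerivAt_id (s : ℂ)).const_mul c).comp_ofReal
  have hqs : ContDiff ℝ ∞ q := ((contDiff_cexp_mul_ofReal c).sub contDiff_const).sub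
    (contDiff_const.mul Complex.ofRealCLM.contDiff)
  have hd1 : deriv q = fun s : ℝ => c * Complex.exp (c * s) - c := by
    funext s
    have := (((hasDerivAt_cexp_mul_ofReal c s).sub_const 1).sub (hcl s)).deriv
    exact this
  have hd2 : ∀ i, iteratedDeriv (i + 2) q = fun s : ℝ => c ^ (i + 2) * Complex.exp (c * s) := by
    intro i
    rw [iteratedDeriv_succ', iteratedDeriv_succ', hd1]
    have : deriv (fun s : ℝ => c * Complex.exp (c * s) - c) =
        fun s : ℝ => c ^ 2 * Complex.exp (c * s) := by
      funext s
      rw [(((hasDerivAt_cexp_mul_ofReal c s).const_mul c).sub_const c).deriv]; ring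
    funext s
    rw [this, iteratedDeriv_const_mul_field, iteratedDeriv_cexp_mul_ofReal]
    ring
  have hpi : 1 ≤ 2 * Real.pi := by linarith [Real.pi_gt_three]
  have hpow : ∀ i ≤ l + 2, (2 * Real.pi) ^ i ≤ (2 * Real.pi) ^ (l + 2) :=
    fun i hi => pow_le_pow_right₀ hpi hi
  have hs : |(inner ℝ v ζ : ℝ)| ≤ ‖v‖ * ‖ζ‖ := abs_real_inner_le_norm v ζ
  have hv0 := norm_nonneg v
  have hz0 := norm_nonneg ζ
  refine (norm_iteratedFDeriv_comp_inner_le hqs v ζ j).trans ?_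
  match j, hj with
  | 0, _ =>
    rw [iteratedDeriv_zero, pow_zero, one_mul]
    calc _ ≤ 3 * (2 * Real.pi * |(inner ℝ v ζ : ℝ)|) ^ 2 := norm_exp_sub_one_sub_le _
      _ ≤ 3 * (2 * Real.pi * (‖v‖ * (1 + ‖ζ‖))) ^ 2 := by
        gcongr; exact hs.trans (by gcongr; linarith)
      _ = 3 * (2 * Real.pi) ^ 2 * ‖v‖ ^ 2 * (1 + ‖ζ‖) ^ 2 := by ring
      _ ≤ _ := by gcongr ?_ * _ * _; exact mul_le_mul_of_nonneg_left (hpow 2 (by omega)) (by norm_num)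
  | 1, _ =>
    rw [iteratedDeriv_one, hd1, pow_one]
    set s : ℝ := inner ℝ v ζ
    have h1 : ‖Complex.exp (c * s) - 1‖ ≤ 2 * Real.pi * |s| := by
      have h := Real.norm_exp_I_mul_ofReal_sub_one_le (x := -(2 * Real.pi * s))
      have e : Complex.I * ((-(2 * Real.pi * s) : ℝ) : ℂ) = c * s := by
        rw [hc]; push_cast; ring
      rw [e, norm_neg, Real.norm_eq_abs, abs_mul, abs_of_pos (by positivity)] at h
      exact h
    have h2 : c * Complex.exp (c * s) - c = c * (Complex.exp (c * s) - 1) := by ring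
    calc ‖v‖ * ‖c * Complex.exp (c * s) - c‖
        ≤ ‖v‖ * (2 * Real.pi * (2 * Real.pi * (‖v‖ * ‖ζ‖))) := by
          rw [h2, norm_mul, hc, norm_neg_two_pi_I, ← hc]
          gcongr
          exact h1.trans (by gcongr)
      _ = (2 * Real.pi) ^ 2 * ‖v‖ ^ 2 * ‖ζ‖ := by ring
      _ ≤ (2 * Real.pi) ^ (l + 2) * ‖v‖ ^ 2 * (3 * (1 + ‖ζ‖) ^ 2) := by
        gcongr ?_ * _ * ?_
        · exact hpow 2 (by omega)
        · nlinarith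
      _ = _ := by ring
  | i + 2, hj =>
    rw [hd2, norm_mul, norm_pow, hc, norm_neg_two_pi_I, norm_cexp_neg_two_pi_I, mul_one]
    calc ‖v‖ ^ (i + 2) * (2 * Real.pi) ^ (i + 2)
        ≤ ‖v‖ ^ 2 * (2 * Real.pi) ^ (l + 2) := by
          gcongr ?_ * ?_
          · exact pow_le_pow_of_le_one hv0 hv (by omega)
          · exact hpow _ (by omega)
      _ = 1 * (2 * Real.pi) ^ (l + 2) * ‖v‖ ^ 2 * 1 := by ring
      _ ≤ _ := by
        gcongr
        · norm_num
        · exact one_le_pow₀ (by linarith)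

variable {N : Type*} [NormedAddCommGroup N] [NormedSpace ℂ N]

theorem norm_clm_modS_le (T : 𝓢(Rd d, ℂ) →L[ℂ] N) (f : 𝓢(Rd d, ℂ)) :
    ∃ (C : ℝ) (m : ℕ), 0 ≤ C ∧ ∀ y, ‖T (modS y f)‖ ≤ C * (1 + ‖y‖) ^ m := by
  obtain ⟨C, m, hC, h⟩ := norm_le_pow_of_seminorm_le T univ (fun y => modS y f)
    (fun y => 1 + ‖y‖) (fun y _ => by linarith [norm_nonneg y]) (fun k l => by
      refine ⟨2 ^ l * 2 ^ (k + 0) *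
        (Finset.Iic (k + 0, l)).sup (schwartzSeminormFamily ℂ (Rd d) ℂ) f * (2 * Real.pi) ^ l, l,
        fun y _ => ?_⟩
      rw [mul_assoc, ← mul_pow]
      refine seminorm_mul_le k l 0 (chr y) f (modS y f) (contDiff_chr y)
        (by positivity) (fun j hj ζ => ?_) (modS_apply y f)
      rw [pow_zero, mul_one]
      have h1 : 1 ≤ 2 * Real.pi * (1 + ‖y‖) := by
        nlinarith [Real.pi_gt_three, norm_nonneg y]
      calc _ ≤ (2 * Real.pi * ‖y‖) ^ j := norm_iteratedFDeriv_chr_le y ζ j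
        _ ≤ (2 * Real.pi * (1 + ‖y‖)) ^ j := by gcongr; linarith
        _ ≤ _ := pow_le_pow_right₀ h1 hj)
  exact ⟨C, m, hC, fun y => h y (mem_univ _)⟩

/-- The derivative of `y ↦ T (e^{-2πi⟨y, ·⟩} f)`. -/
noncomputable def modDeriv (T : 𝓢(Rd d, ℂ) →L[ℂ] N) (f : 𝓢(Rd d, ℂ)) (y : Rd d) : Rd d →L[ℝ] N :=
  LinearMap.toContinuousLinearMap
    { toFun := fun v => T (modS y (linS v f))
      map_add' := fun v w => by
        rw [← map_add, ← map_add]; congr 2; ext ζ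
        simp only [add_apply, linS_apply, inner_add_left]; push_cast; ring
      map_smul' := fun r v => by
        have : linS (r • v) f = (r : ℂ) • linS v f := by
          ext ζ
          simp only [smul_apply, linS_apply, real_inner_smul_left, smul_eq_mul]
          push_cast; ring
        rw [this, map_smul, map_smul, RingHom.id_apply, Complex.coe_smul] }

theorem modDeriv_apply (T : 𝓢(Rd d, ℂ) →L[ℂ] N) (f : 𝓢(Rd d, ℂ)) (y v : Rd d) :
    modDeriv T f y v = T (modS y (linS v f)) := rfl

theorem hasFDerivAt_clm_modS (T : 𝓢(Rd d, ℂ) →L[ℂ] N) (f : 𝓢(Rd d, ℂ)) (y : Rd d) :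
    HasFDerivAt (fun y => T (modS y f)) (modDeriv T f y) y := by
  rw [hasFDerivAt_iff_isLittleO_nhds_zero]
  obtain ⟨C, hC, h⟩ := norm_le_of_seminorm_le (T.comp (modS y)) {v : Rd d | ‖v‖ ≤ 1}
    (fun v => modS v f - f - linS v f) (fun v => ‖v‖ ^ 2) (fun v _ => by positivity)
    (fun k l => by
      refine ⟨2 ^ l * 2 ^ (k + 2) *
        (Finset.Iic (k + 2, l)).sup (schwartzSeminormFamily ℂ (Rd d) ℂ) f *
          (3 * (2 * Real.pi) ^ (l + 2)), fun v hv => ?_⟩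
      rw [mul_assoc]
      refine seminorm_mul_le k l 2
        (fun ζ => chr v ζ - 1 - -(2 * Real.pi * Complex.I) * (inner ℝ v ζ : ℝ)) f _ ?_
        (by positivity) (fun j hj ζ => norm_iteratedFDeriv_chr_remainder_le hv ζ l j hj) ?_
      · exact ((contDiff_chr v).sub contDiff_const).sub (hasTemperateGrowth_lin v).1
      · intro ζ
        simp only [sub_apply, modS_apply, linS_apply]; ring)
  have hO : (fun v : Rd d => T (modS (y + v) f) - T (modS y f) - modDeriv T f y v)
      =O[𝓝 0] fun v => ‖v‖ ^ 2 := by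
    refine Asymptotics.IsBigO.of_bound C ?_
    filter_upwards [Metric.closedBall_mem_nhds (0 : Rd d) one_pos] with v hv
    rw [mem_closedBall_zero_iff] at hv
    rw [modS_add, modDeriv_apply, ← map_sub, ← map_sub, ← map_sub, ← map_sub,
      Real.norm_of_nonneg (by positivity)]
    exact h v hv
  exact hO.trans_isLittleO (Asymptotics.isLittleO_norm_pow_id one_lt_two)

theorem continuous_clm_modS (T : 𝓢(Rd d, ℂ) →L[ℂ] N) (f : 𝓢(Rd d, ℂ)) :
    Continuous (fun y => T (modS y f)) :=
  continuous_iff_continuousAt.2 fun y => (hasFDerivAt_clm_modS T f y).continuousAt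

/-- The derivative is a finite sum of functions of the same shape, with `f` multiplied by a
coordinate, so that an induction over derivatives closes. -/
theorem fderiv_clm_modS (T : 𝓢(Rd d, ℂ) →L[ℂ] N) (f : 𝓢(Rd d, ℂ)) :
    fderiv ℝ (fun y => T (modS y f)) = fun y => ∑ i : Fin d,
      ContinuousLinearMap.smulRightL ℝ (Rd d) N (EuclideanSpace.proj i)
        (T (modS y (linS (EuclideanSpace.single i 1) f))) := by
  funext y
  rw [(hasFDerivAt_clm_modS T f y).fderiv]
  ext v
  conv_lhs => rw [← (EuclideanSpace.basisFun (Fin d) ℝ).sum_repr v]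
  simp [modDeriv_apply]

theorem hasTemperateGrowth_clm_modS (T : 𝓢(Rd d, ℂ) →L[ℂ] N) (f : 𝓢(Rd d, ℂ)) :
    (fun y => T (modS y f)).HasTemperateGrowth := by
  -- The induction must quantify over `f`, because each derivative replaces `f` by its multiples
  -- with linear functions.
  have key : ∀ n : ℕ, ∀ f : 𝓢(Rd d, ℂ), ContDiff ℝ n (fun y => T (modS y f)) ∧
      ∃ (k : ℕ) (C : ℝ), ∀ y, ‖iteratedFDeriv ℝ n (fun y => T (modS y f)) y‖ ≤
        C * (1 + ‖y‖) ^ k := by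
    intro n
    induction n with
    | zero =>
      intro f
      obtain ⟨C, m, -, h⟩ := norm_clm_modS_le T f
      refine ⟨contDiff_zero.2 (continuous_clm_modS T f), m, C, fun y => ?_⟩
      simpa using h y
    | succ n ih =>
      intro f
      choose hs k C hk using ih
      set A : Fin d → (N →L[ℝ] (Rd d →L[ℝ] N)) := fun i =>
        ContinuousLinearMap.smulRightL ℝ (Rd d) N (EuclideanSpace.proj i) with hA
      set e : Fin d → 𝓢(Rd d, ℂ) := fun i => linS (EuclideanSpace.single i 1) f with he
      have hfd := fderiv_clm_modS T f
      have hsm : ∀ i, ContDiff ℝ n (fun y => A i (T (modS y (e i)))) := fun i =>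
        (A i).contDiff.comp (hs (e i))
      refine ⟨?_, ∑ i, k (e i), ∑ i, ‖A i‖ * |C (e i)|, fun y => ?_⟩
      · push_cast
        rw [contDiff_succ_iff_fderiv]
        refine ⟨fun y => (hasFDerivAt_clm_modS T f y).differentiableAt, by simp, ?_⟩
        rw [hfd]
        exact ContDiff.sum fun i _ => hsm i
      · rw [← norm_iteratedFDeriv_fderiv, hfd]
        have hsum : iteratedFDeriv ℝ n (fun y => ∑ i, A i (T (modS y (e i)))) y =
            ∑ i, iteratedFDeriv ℝ n (fun y => A i (T (modS y (e i)))) y :=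
          iteratedFDeriv_fun_sum_apply fun i _ => (hsm i).contDiffAt
        change ‖iteratedFDeriv ℝ n (fun y => ∑ i, A i (T (modS y (e i)))) y‖ ≤ _
        rw [hsum, Finset.sum_mul]
        refine norm_sum_le_of_le _ fun i _ => ?_
        have h1 : iteratedFDeriv ℝ n (fun y => A i (T (modS y (e i)))) y =
            (A i).compContinuousMultilinearMap (iteratedFDeriv ℝ n
              (fun y => T (modS y (e i))) y) :=
          (A i).iteratedFDeriv_comp_left (hs (e i)).contDiffAt le_rfl
        rw [h1]
        refine (ContinuousLinearMap.norm_compContinuousMultilinearMap_le _ _).trans ?_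
        rw [mul_assoc]
        gcongr
        refine (hk (e i) y).trans ?_
        gcongr
        · exact le_abs_self _
        · linarith [norm_nonneg y]
        · exact Finset.single_le_sum (f := fun i => k (e i)) (fun _ _ => Nat.zero_le _)
            (Finset.mem_univ i)
  exact ⟨contDiff_infty.2 fun n => (key n f).1, fun n => (key n f).2⟩

end Modulation

/-! ### Moving a distribution under a Fourier integral -/

section Exchange

variable {d : ℕ}

/-- Bounded continuous functions on `ℝ^d` with values in the `l`-linear maps. -/
def BddMultilinear (d l : ℕ) : Type :=
  BoundedContinuousFunction (Rd d) (ContinuousMultilinearMap ℝ (fun _ : Fin l => Rd d) ℂ)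

noncomputable instance (d l : ℕ) : NormedAddCommGroup (BddMultilinear d l) :=
  inferInstanceAs (NormedAddCommGroup (BoundedContinuousFunction (Rd d)
    (ContinuousMultilinearMap ℝ (fun _ : Fin l => Rd d) ℂ)))

noncomputable instance (d l : ℕ) : NormedSpace ℂ (BddMultilinear d l) :=
  inferInstanceAs (NormedSpace ℂ (BoundedContinuousFunction (Rd d)
    (ContinuousMultilinearMap ℝ (fun _ : Fin l => Rd d) ℂ)))

instance (d l : ℕ) : CompleteSpace (BddMultilinear d l) :=
  inferInstanceAs (CompleteSpace (BoundedContinuousFunction (Rd d)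
    (ContinuousMultilinearMap ℝ (fun _ : Fin l => Rd d) ℂ)))

namespace BddMultilinear

/-- Evaluation at a point. -/
noncomputable def eval {l : ℕ} (ζ : Rd d) :
    BddMultilinear d l →L[ℂ] ContinuousMultilinearMap ℝ (fun _ : Fin l => Rd d) ℂ :=
  BoundedContinuousFunction.evalCLM ℂ ζ

theorem ext_eval {l : ℕ} {f g : BddMultilinear d l} (h : ∀ ζ, eval ζ f = eval ζ g) : f = g :=
  BoundedContinuousFunction.ext h

theorem norm_eval_le {l : ℕ} (ζ : Rd d) (f : BddMultilinear d l) : ‖eval ζ f‖ ≤ ‖f‖ :=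
  BoundedContinuousFunction.norm_coe_le_norm _ ζ

end BddMultilinear

/-- The weighted derivative `ζ ↦ |ζ|^k D^l f(ζ)` as a bounded continuous function. -/
noncomputable def weightedDerivFun (k l : ℕ) (f : 𝓢(Rd d, ℂ)) : BddMultilinear d l :=
  BoundedContinuousFunction.ofNormedAddCommGroup
    (fun ζ => ‖ζ‖ ^ k • iteratedFDeriv ℝ l f ζ)
    ((continuous_norm.pow k).smul ((f.smooth l).continuous_iteratedFDeriv le_rfl))
    (SchwartzMap.seminorm ℂ k l f)
    (fun ζ => by
      rw [norm_smul, norm_pow, norm_norm]; exact SchwartzMap.le_seminorm ℂ k l f ζ)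

theorem eval_weightedDerivFun (k l : ℕ) (f : 𝓢(Rd d, ℂ)) (ζ : Rd d) :
    BddMultilinear.eval ζ (weightedDerivFun k l f) = ‖ζ‖ ^ k • iteratedFDeriv ℝ l f ζ := rfl

/-- The weighted derivative as a continuous linear map. -/
noncomputable def weightedDeriv (k l : ℕ) : 𝓢(Rd d, ℂ) →L[ℂ] BddMultilinear d l :=
  SchwartzMap.mkCLMtoNormedSpace (weightedDerivFun k l)
    (fun f g => BddMultilinear.ext_eval fun ζ => by
      have h : iteratedFDeriv ℝ l (⇑(f + g)) ζ = iteratedFDeriv ℝ l f ζ + iteratedFDeriv ℝ l g ζ :=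
        iteratedFDeriv_add_apply (f.smooth l).contDiffAt (g.smooth l).contDiffAt
      rw [map_add, eval_weightedDerivFun, eval_weightedDerivFun, eval_weightedDerivFun, h,
        smul_add])
    (fun c f => BddMultilinear.ext_eval fun ζ => by
      have h : iteratedFDeriv ℝ l (⇑(c • f)) ζ = c • iteratedFDeriv ℝ l f ζ :=
        iteratedFDeriv_const_smul_apply (f.smooth l).contDiffAt
      rw [map_smul, eval_weightedDerivFun, eval_weightedDerivFun, h, smul_comm (‖ζ‖ ^ k) c]
      rfl)
    ⟨{(k, l)}, 1, zero_le_one, fun f => by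
      rw [one_mul, Finset.sup_singleton, SchwartzMap.schwartzSeminormFamily_apply]
      exact BoundedContinuousFunction.norm_ofNormedAddCommGroup_le _ (apply_nonneg _ _) _⟩

theorem eval_weightedDeriv (k l : ℕ) (f : 𝓢(Rd d, ℂ)) (ζ : Rd d) :
    BddMultilinear.eval ζ (weightedDeriv k l f) = ‖ζ‖ ^ k • iteratedFDeriv ℝ l f ζ := rfl

theorem seminorm_le_norm_weightedDeriv (k l : ℕ) (f : 𝓢(Rd d, ℂ)) :
    SchwartzMap.seminorm ℂ k l f ≤ ‖weightedDeriv k l f‖ := by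
  refine SchwartzMap.seminorm_le_bound ℂ k l f (norm_nonneg _) fun ζ => ?_
  have := BddMultilinear.norm_eval_le ζ (weightedDeriv k l f)
  rwa [eval_weightedDeriv, norm_smul, norm_pow, norm_norm] at this

/-- The family of the weighted derivatives indexed by `s`. -/
noncomputable def weightedDerivs (s : Finset (ℕ × ℕ)) : 𝓢(Rd d, ℂ) →L[ℂ]
    ((i : s) → BddMultilinear d i.1.2) :=
  ContinuousLinearMap.pi fun i => weightedDeriv i.1.1 i.1.2

/-- Bochner integration needs a Banach space. By Hahn–Banach a distribution of finite order factors
through finitely many weighted derivatives, regarded as bounded continuous functions. -/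
theorem exists_factor_weightedDerivs (u : 𝓢(Rd d, ℂ) →L[ℂ] ℂ) :
    ∃ (s : Finset (ℕ × ℕ)) (ℓ : ((i : s) → BddMultilinear d i.1.2) →L[ℂ] ℂ),
      ∀ f, ℓ (weightedDerivs s f) = u f := by
  obtain ⟨s₀, C, hC, hu⟩ := exists_seminorm_bound u
  -- The index `(0, 0)` makes `weightedDerivs s` injective, so `u` descends to its range.
  set s := insert ((0, 0) : ℕ × ℕ) s₀ with hs
  have hle : ∀ i ∈ s, ∀ f : 𝓢(Rd d, ℂ),
      SchwartzMap.seminorm ℂ i.1 i.2 f ≤ ‖weightedDerivs s f‖ := fun i hi f =>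
    (seminorm_le_norm_weightedDeriv i.1 i.2 f).trans
      (norm_le_pi_norm (weightedDerivs s f) ⟨i, hi⟩)
  have hus : ∀ f, ‖u f‖ ≤ C * ‖weightedDerivs s f‖ := fun f => by
    refine (hu f).trans (mul_le_mul_of_nonneg_left ?_ hC)
    exact Seminorm.finset_sup_apply_le (norm_nonneg _) fun i hi =>
      hle i (Finset.mem_insert_of_mem hi) f
  have hinj : Function.Injective (weightedDerivs (d := d) s).toLinearMap := by
    refine (injective_iff_map_eq_zero _).2 fun f hf => ?_
    ext ζ
    have h1 := hle (0, 0) (Finset.mem_insert_self _ _) f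
    have h2 : weightedDerivs s f = 0 := hf
    rw [h2, norm_zero] at h1
    have h3 := (SchwartzMap.norm_le_seminorm ℂ f ζ).trans h1
    simpa using h3
  set e := LinearEquiv.ofInjective (weightedDerivs (d := d) s).toLinearMap hinj with he
  have hes : ∀ x, weightedDerivs s (e.symm x) = x := fun x => by
    have := e.apply_symm_apply x
    exact congrArg Subtype.val this
  set g₀ := (u.toLinearMap.comp e.symm.toLinearMap).mkContinuous C (fun x => by
    refine (hus (e.symm x)).trans (le_of_eq ?_)
    rw [hes]; rfl) with hg₀
  obtain ⟨ℓ, hℓ, -⟩ := exists_extension_norm_eq _ g₀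
  refine ⟨s, ℓ, fun f => ?_⟩
  have h := hℓ (e f)
  have h1 : g₀ (e f) = u f := by
    change u (e.symm (e f)) = u f
    rw [LinearEquiv.symm_apply_apply]
  rw [h1] at h
  exact h

theorem integrable_one_add_norm_pow_mul (G : 𝓢(Rd d, ℂ)) (m : ℕ) :
    Integrable (fun y => (1 + ‖y‖) ^ m * ‖G y‖) := by
  have h := ((G.integrable_pow_mul volume 0).add (G.integrable_pow_mul volume m)).const_mul
    (2 ^ (m - 1))
  refine h.mono' (by fun_prop) (Filter.Eventually.of_forall fun y => ?_)
  rw [Real.norm_of_nonneg (by positivity)]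
  have := add_pow_le zero_le_one (norm_nonneg y) m
  simp only [Pi.add_apply, pow_zero, ← add_mul, ← mul_assoc]
  rw [one_pow] at this
  gcongr

theorem integrable_smul_clm_modS {N : Type*} [NormedAddCommGroup N] [NormedSpace ℂ N]
    (T : 𝓢(Rd d, ℂ) →L[ℂ] N) (f G : 𝓢(Rd d, ℂ)) :
    Integrable (fun y => G y • T (modS y f)) := by
  obtain ⟨C, m, hC, h⟩ := norm_clm_modS_le T f
  refine ((integrable_one_add_norm_pow_mul G m).const_mul C).mono'
    (G.continuous.smul (continuous_clm_modS T f)).aestronglyMeasurable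
    (Filter.Eventually.of_forall fun y => ?_)
  rw [norm_smul]
  calc _ ≤ ‖G y‖ * (C * (1 + ‖y‖) ^ m) := by gcongr; exact h y
    _ = _ := by ring

/-- Evaluation of the `l`-th derivative at `ζ`. -/
noncomputable def derivAt (l : ℕ) (ζ : Rd d) :
    𝓢(Rd d, ℂ) →L[ℂ] ContinuousMultilinearMap ℝ (fun _ : Fin l => Rd d) ℂ :=
  (BddMultilinear.eval ζ).comp (weightedDeriv 0 l)

theorem derivAt_apply (l : ℕ) (ζ : Rd d) (f : 𝓢(Rd d, ℂ)) :
    derivAt l ζ f = iteratedFDeriv ℝ l f ζ := by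
  change BddMultilinear.eval ζ (weightedDeriv 0 l f) = _
  rw [eval_weightedDeriv, pow_zero, one_smul]

theorem mul_fourier_eq_integral (f G : 𝓢(Rd d, ℂ)) (ζ : Rd d) :
    f ζ * (𝓕 G) ζ = ∫ y, G y • modS y f ζ := by
  rw [SchwartzMap.fourier_coe, Real.fourier_eq, ← integral_const_mul]
  refine integral_congr_ae (Filter.Eventually.of_forall fun y => ?_)
  simp only [modS_apply, chr_eq_fourierChar, Circle.smul_def, smul_eq_mul]
  ring

/-- Differentiation under the integral sign, one order at a time. -/
theorem iteratedFDeriv_eq_integral (f G F : 𝓢(Rd d, ℂ)) (hF : ∀ ζ, F ζ = f ζ * (𝓕 G) ζ) (l : ℕ) :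
    ∀ ζ, iteratedFDeriv ℝ l F ζ = ∫ y, G y • iteratedFDeriv ℝ l (modS y f) ζ := by
  have hint : ∀ l ζ, Integrable fun y => G y • iteratedFDeriv ℝ l (modS y f) ζ := fun l ζ => by
    simpa only [derivAt_apply] using integrable_smul_clm_modS (derivAt l ζ) f G
  induction l with
  | zero =>
    intro ζ
    simp only [iteratedFDeriv_zero_eq_comp, Function.comp_apply]
    rw [hF, mul_fourier_eq_integral]
    have h := (continuousMultilinearCurryFin0 ℝ (Rd d) ℂ).symm.toContinuousLinearEquiv.integral_comp_comm
      (μ := volume) (fun y => G y • modS y f ζ)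
    refine h.symm.trans (integral_congr_ae (Filter.Eventually.of_forall fun y => ?_))
    ext1 v
    simp
  | succ l ih =>
    intro ζ
    have hfun : iteratedFDeriv ℝ l F = fun ζ => ∫ y, G y • iteratedFDeriv ℝ l (modS y f) ζ :=
      funext ih
    set e := continuousMultilinearCurryLeftEquiv ℝ (fun _ : Fin (l + 1) => Rd d) ℂ with he
    have hfd : ∀ g : 𝓢(Rd d, ℂ), ∀ ζ, fderiv ℝ (iteratedFDeriv ℝ l g) ζ =
        e (iteratedFDeriv ℝ (l + 1) g ζ) := fun g ζ => by
      rw [fderiv_iteratedFDeriv]; rfl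
    -- The sup norm of the next derivative is a dominating function independent of `ζ`.
    have hbd : Integrable fun y => ‖G y • weightedDeriv 0 (l + 1) (modS y f)‖ :=
      (integrable_smul_clm_modS (weightedDeriv 0 (l + 1)) f G).norm
    have hsm : ∀ y ζ, G y • fderiv ℝ (iteratedFDeriv ℝ l (modS y f)) ζ =
        e (G y • iteratedFDeriv ℝ (l + 1) (modS y f) ζ) := fun y ζ => by
      rw [hfd]; ext v w; rfl
    have key := hasFDerivAt_integral_of_dominated_of_fderiv_le (𝕜 := ℝ) (μ := volume)
      (F := fun ζ y => G y • iteratedFDeriv ℝ l (modS y f) ζ)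
      (F' := fun ζ y => G y • fderiv ℝ (iteratedFDeriv ℝ l (modS y f)) ζ)
      (x₀ := ζ) (s := univ) (bound := fun y => ‖G y • weightedDeriv 0 (l + 1) (modS y f)‖)
      Filter.univ_mem (Filter.Eventually.of_forall fun ζ => (hint l ζ).aestronglyMeasurable)
      (hint l ζ) ?_ ?_ hbd ?_
    · rw [← e.symm_apply_apply (iteratedFDeriv ℝ (l + 1) F ζ), ← hfd, hfun, key.fderiv]
      simp only [hsm]
      have h := ContinuousLinearMap.integral_comp_comm (𝕜 := ℝ)
        (E := ContinuousMultilinearMap ℝ (fun _ : Fin (l + 1) => Rd d) ℂ)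
        (Fₗ := Rd d →L[ℝ] ContinuousMultilinearMap ℝ (fun _ : Fin l => Rd d) ℂ)
        e.toContinuousLinearEquiv (hint (l + 1) ζ)
      exact (congrArg e.symm h).trans (e.symm_apply_apply _)
    · simp only [hsm]
      exact e.continuous.comp_aestronglyMeasurable (hint (l + 1) ζ).aestronglyMeasurable
    · refine Filter.Eventually.of_forall fun y ζ _ => ?_
      rw [hsm, LinearIsometryEquiv.norm_map, norm_smul, norm_smul]
      refine mul_le_mul_of_nonneg_left ?_ (norm_nonneg _)
      have := BddMultilinear.norm_eval_le ζ (weightedDeriv 0 (l + 1) (modS y f))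
      rwa [eval_weightedDeriv, pow_zero, one_smul] at this
    · refine Filter.Eventually.of_forall fun y ζ _ => ?_
      have hd : Differentiable ℝ (iteratedFDeriv ℝ l (modS y f)) :=
        ((modS y f).smooth (l + 1)).differentiable_iteratedFDeriv (by exact_mod_cast l.lt_succ_self)
      exact (hd ζ).hasFDerivAt.const_smul (G y)

/-- Pairing a distribution with `f · 𝓕 G` can be computed under the Fourier integral. -/
theorem clm_mul_fourier_eq_integral (u : 𝓢(Rd d, ℂ) →L[ℂ] ℂ) (f G F : 𝓢(Rd d, ℂ))
    (hF : ∀ ζ, F ζ = f ζ * (𝓕 G) ζ) : u F = ∫ y, G y * u (modS y f) := by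
  obtain ⟨s, ℓ, hℓ⟩ := exists_factor_weightedDerivs u
  have hint := integrable_smul_clm_modS (weightedDerivs s) f G
  -- An identity in the Banach space, verified by evaluating each component at each point, where it
  -- is differentiation under the integral.
  have hJ : weightedDerivs s F = ∫ y, G y • weightedDerivs s (modS y f) := by
    funext i
    refine BddMultilinear.ext_eval fun ζ => ?_
    have h := ((BddMultilinear.eval ζ).comp
      (ContinuousLinearMap.proj (R := ℂ) (φ := fun i : s => BoundedContinuousFunction (Rd d)
        (ContinuousMultilinearMap ℝ (fun _ : Fin i.1.2 => Rd d) ℂ)) i)).integral_comp_comm hint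
    refine Eq.trans ?_ h
    change ‖ζ‖ ^ i.1.1 • iteratedFDeriv ℝ i.1.2 F ζ =
      ∫ y, G y • ‖ζ‖ ^ i.1.1 • iteratedFDeriv ℝ i.1.2 (modS y f) ζ
    rw [iteratedFDeriv_eq_integral f G F hF, ← integral_smul]
    simp only [smul_comm (‖ζ‖ ^ i.1.1)]
  rw [← hℓ, hJ, ← ℓ.integral_comp_comm hint]
  simp only [map_smul, hℓ, smul_eq_mul]

end Exchange

/-! ### Norms and determinants for the dual action -/

section DualAction

variable {d : ℕ}

/-- The dual action of `h` as a continuous linear map. -/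
noncomputable def dualCLM (h : GL (Fin d) ℝ) : Rd d →L[ℝ] Rd d :=
  Matrix.toEuclideanCLM (n := Fin d) (𝕜 := ℝ) (h : Matrix (Fin d) (Fin d) ℝ).transpose

theorem dualCLM_apply (h : GL (Fin d) ℝ) (ξ : Rd d) : dualCLM h ξ = dualAct h ξ := rfl

theorem dualCLM_eq_adjoint (h : GL (Fin d) ℝ) :
    dualCLM h = ContinuousLinearMap.adjoint
      (Matrix.toEuclideanCLM (n := Fin d) (𝕜 := ℝ) (h : Matrix (Fin d) (Fin d) ℝ)) := by
  rw [← ContinuousLinearMap.star_eq_adjoint, ← map_star, dualCLM, Matrix.star_eq_conjTranspose,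
    Matrix.conjTranspose_eq_transpose_of_trivial]

theorem norm_dualCLM (h : GL (Fin d) ℝ) : ‖dualCLM h‖ = opNorm h := by
  rw [dualCLM_eq_adjoint, LinearIsometryEquiv.norm_map]; rfl

theorem inner_dualAct (h : GL (Fin d) ℝ) (x ξ : Rd d) :
    inner ℝ x (dualAct h ξ) = inner ℝ (linEquiv h x) ξ := by
  rw [← dualCLM_apply, dualCLM_eq_adjoint, ContinuousLinearMap.adjoint_inner_right]; rfl

theorem dualAct_mul (g h : GL (Fin d) ℝ) (ξ : Rd d) :
    dualAct (g * h) ξ = dualAct h (dualAct g ξ) := by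
  simp only [dualAct, Units.val_mul, Matrix.transpose_mul, map_mul]; rfl

theorem dualAct_one (ξ : Rd d) : dualAct 1 ξ = ξ := by
  simp [dualAct]

theorem dualAct_dualAct_inv (h : GL (Fin d) ℝ) (ξ : Rd d) : dualAct h (dualAct h⁻¹ ξ) = ξ := by
  rw [← dualAct_mul, inv_mul_cancel, dualAct_one]

theorem dualAct_inv_dualAct (h : GL (Fin d) ℝ) (ξ : Rd d) : dualAct h⁻¹ (dualAct h ξ) = ξ := by
  rw [← dualAct_mul, mul_inv_cancel, dualAct_one]

theorem dualAct_smul (h : GL (Fin d) ℝ) (r : ℝ) (ξ : Rd d) :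
    dualAct h (r • ξ) = r • dualAct h ξ := (dualCLM h).map_smul r ξ

theorem dualAct_add (h : GL (Fin d) ℝ) (ξ η : Rd d) :
    dualAct h (ξ + η) = dualAct h ξ + dualAct h η := (dualCLM h).map_add ξ η

theorem dualAct_neg (h : GL (Fin d) ℝ) (ξ : Rd d) :
    dualAct h (-ξ) = -dualAct h ξ := (dualCLM h).map_neg ξ

theorem dualAct_zero (h : GL (Fin d) ℝ) : dualAct h (0 : Rd d) = 0 := (dualCLM h).map_zero

theorem continuous_dualAct (h : GL (Fin d) ℝ) : Continuous (dualAct h) := (dualCLM h).continuous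

theorem norm_dualAct_le (h : GL (Fin d) ℝ) (ξ : Rd d) : ‖dualAct h ξ‖ ≤ opNorm h * ‖ξ‖ := by
  rw [← dualCLM_apply, ← norm_dualCLM]; exact ContinuousLinearMap.le_opNorm _ _

theorem opNorm_nonneg (h : GL (Fin d) ℝ) : 0 ≤ opNorm h := norm_nonneg _

theorem opNorm_mul_le (g h : GL (Fin d) ℝ) : opNorm (g * h) ≤ opNorm g * opNorm h := by
  simp only [opNorm, Units.val_mul, map_mul]; exact norm_mul_le _ _

theorem norm_linEquiv (h : GL (Fin d) ℝ) : ‖(linEquiv h : Rd d →L[ℝ] Rd d)‖ = opNorm h := rfl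

theorem linEquiv_linEquiv_inv (h : GL (Fin d) ℝ) (x : Rd d) :
    linEquiv h (linEquiv h⁻¹ x) = x := by
  have : (linEquiv h * linEquiv h⁻¹ : Rd d ≃L[ℝ] Rd d) = 1 := by
    rw [linEquiv, linEquiv, ← map_mul, ← map_mul, mul_inv_cancel, map_one, map_one]
  exact DFunLike.congr_fun this x

theorem linEquiv_inv_linEquiv (h : GL (Fin d) ℝ) (x : Rd d) :
    linEquiv h⁻¹ (linEquiv h x) = x := by
  simpa using linEquiv_linEquiv_inv h⁻¹ x

theorem linEquiv_inv_symm (h : GL (Fin d) ℝ) : (linEquiv h⁻¹).symm = linEquiv h := by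
  refine DFunLike.ext _ _ fun x => ?_
  rw [ContinuousLinearEquiv.symm_apply_eq, linEquiv_inv_linEquiv]

theorem norm_linEquiv_le (h : GL (Fin d) ℝ) (x : Rd d) : ‖linEquiv h x‖ ≤ opNorm h * ‖x‖ := by
  rw [← norm_linEquiv]; exact ContinuousLinearMap.le_opNorm (linEquiv h : Rd d →L[ℝ] Rd d) x

theorem abs_det_le (h : GL (Fin d) ℝ) :
    |(h : Matrix (Fin d) (Fin d) ℝ).det| ≤ d.factorial * opNorm h ^ d := by
  have := Matrix.det_le (A := (h : Matrix (Fin d) (Fin d) ℝ))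
    (abv := (AbsoluteValue.abs : AbsoluteValue ℝ ℝ)) (x := opNorm h) (fun i j => by
      have h1 : (h : Matrix (Fin d) (Fin d) ℝ) i j =
          inner ℝ (EuclideanSpace.single i (1 : ℝ)) (linEquiv h (EuclideanSpace.single j 1)) := by
        rw [linEquiv_apply, EuclideanSpace.inner_single_left]
        simp
      change |(h : Matrix (Fin d) (Fin d) ℝ) i j| ≤ _
      rw [h1]
      refine (abs_real_inner_le_norm _ _).trans ?_
      rw [PiLp.norm_single, norm_one, one_mul]
      refine (norm_linEquiv_le _ _).trans ?_
      rw [PiLp.norm_single, norm_one, mul_one])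
  simpa using this

theorem det_ne_zero (h : GL (Fin d) ℝ) : (h : Matrix (Fin d) (Fin d) ℝ).det ≠ 0 :=
  Matrix.GeneralLinearGroup.det_ne_zero h

theorem abs_det_pos (h : GL (Fin d) ℝ) : 0 < |(h : Matrix (Fin d) (Fin d) ℝ).det| :=
  abs_pos.2 (det_ne_zero h)

theorem abs_det_inv (h : GL (Fin d) ℝ) :
    |((h⁻¹ : GL (Fin d) ℝ) : Matrix (Fin d) (Fin d) ℝ).det| =
      |(h : Matrix (Fin d) (Fin d) ℝ).det|⁻¹ := by
  rw [Matrix.coe_units_inv, Matrix.det_nonsing_inv, Ring.inverse_eq_inv', abs_inv]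

theorem inv_abs_det_le (h : GL (Fin d) ℝ) :
    |(h : Matrix (Fin d) (Fin d) ℝ).det|⁻¹ ≤ d.factorial * (1 + opNorm h⁻¹) ^ d := by
  rw [← abs_det_inv]
  refine (abs_det_le _).trans ?_
  have := opNorm_nonneg h⁻¹
  gcongr
  linarith

/-- The normalizing factor `|det h|^{-1/2}`. -/
noncomputable def detFactor (h : GL (Fin d) ℝ) : ℝ :=
  |(h : Matrix (Fin d) (Fin d) ℝ).det| ^ (-(1 / 2) : ℝ)

theorem detFactor_pos (h : GL (Fin d) ℝ) : 0 < detFactor h :=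
  Real.rpow_pos_of_pos (abs_det_pos h) _

theorem detFactor_sq (h : GL (Fin d) ℝ) :
    detFactor h * detFactor h = |(h : Matrix (Fin d) (Fin d) ℝ).det|⁻¹ := by
  rw [detFactor, ← Real.rpow_add (abs_det_pos h), ← Real.rpow_neg_one]; norm_num

/-- The square of the factor is `|det h|⁻¹`; a factor above one is at most its square. The bound
keeps an integer power in place of a square root. -/
theorem detFactor_le (h : GL (Fin d) ℝ) :
    detFactor h ≤ (1 + d.factorial) * (1 + opNorm h⁻¹) ^ d := by
  have h1 := detFactor_sq h
  have h2 := inv_abs_det_le h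
  have h3 := detFactor_pos h
  have h4 : 1 ≤ (1 + opNorm h⁻¹) ^ d := one_le_pow₀ (by linarith [opNorm_nonneg h⁻¹])
  rcases le_total (detFactor h) 1 with h5 | h5
  · nlinarith [(Nat.cast_nonneg d.factorial : (0 : ℝ) ≤ d.factorial)]
  · nlinarith

theorem inv_detFactor_le (h : GL (Fin d) ℝ) :
    (detFactor h)⁻¹ ≤ 1 + d.factorial * opNorm h ^ d := by
  have h1 := detFactor_sq h
  have h2 := abs_det_le h
  have h3 := inv_pos.2 (detFactor_pos h)
  have h4 : (detFactor h)⁻¹ * (detFactor h)⁻¹ = |(h : Matrix (Fin d) (Fin d) ℝ).det| := by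
    rw [← mul_inv, h1, inv_inv]
  rcases le_total (detFactor h)⁻¹ 1 with h5 | h5
  · nlinarith [abs_nonneg (h : Matrix (Fin d) (Fin d) ℝ).det]
  · nlinarith

end DualAction

/-! ### Cones, truncated cones and outer sets -/

section Cones

variable {d : ℕ}

theorem mem_cone_iff {W : Set (Sph d)} {η : Rd d} :
    η ∈ cone W ↔ η ≠ 0 ∧ ‖η‖⁻¹ • η ∈ (Subtype.val '' W : Set (Rd d)) := by
  constructor
  · rintro ⟨w, hw, r, hr, rfl⟩
    have hw1 : ‖(w : Rd d)‖ = 1 := mem_sphere_zero_iff_norm.1 w.2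
    have hw0 : (w : Rd d) ≠ 0 := fun h => by simp [h] at hw1
    refine ⟨smul_ne_zero hr.ne' hw0, w, hw, ?_⟩
    rw [norm_smul, hw1, mul_one, Real.norm_of_nonneg hr.le, smul_smul, inv_mul_cancel₀ hr.ne',
      one_smul]
  · rintro ⟨h0, w, hw, hwe⟩
    refine ⟨w, hw, ‖η‖, norm_pos_iff.2 h0, ?_⟩
    rw [hwe, smul_smul, mul_inv_cancel₀ (norm_ne_zero_iff.2 h0), one_smul]

theorem isOpen_cone {W : Set (Sph d)} (hW : IsOpen W) : IsOpen (cone W) := by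
  obtain ⟨W', hW', rfl⟩ := isOpen_induced_iff.1 hW
  have h : cone (Subtype.val ⁻¹' W' : Set (Sph d)) =
      {η : Rd d | η ≠ 0} ∩ (fun η => ‖η‖⁻¹ • η) ⁻¹' W' := by
    ext η
    rw [mem_cone_iff]
    refine and_congr_right fun h0 => ?_
    rw [Subtype.image_preimage_coe]
    refine ⟨fun h => h.2, fun h => ⟨?_, h⟩⟩
    rw [mem_sphere_zero_iff_norm, norm_smul, norm_inv, norm_norm,
      inv_mul_cancel₀ (norm_ne_zero_iff.2 h0)]
  rw [h]
  refine ContinuousOn.isOpen_inter_preimage ?_ isOpen_ne hW'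
  exact (continuous_norm.continuousOn.inv₀ fun η h => norm_ne_zero_iff.2 h).smul continuousOn_id

theorem smul_mem_cone {W : Set (Sph d)} {η : Rd d} (h : η ∈ cone W) {r : ℝ} (hr : 0 < r) :
    r • η ∈ cone W := by
  obtain ⟨w, hw, s, hs, rfl⟩ := h
  exact ⟨w, hw, r * s, mul_pos hr hs, by rw [smul_smul]⟩

theorem coe_mem_cone {W : Set (Sph d)} {w : Sph d} (h : w ∈ W) : (w : Rd d) ∈ cone W :=
  ⟨w, h, 1, one_pos, by rw [one_smul]⟩

theorem cone_mono {W W' : Set (Sph d)} (h : W ⊆ W') : cone W ⊆ cone W' := by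
  rintro η ⟨w, hw, r, hr, rfl⟩; exact ⟨w, h hw, r, hr, rfl⟩

theorem mem_coneAbove {W : Set (Sph d)} {R : ℝ} {η : Rd d} :
    η ∈ coneAbove W R ↔ η ∈ cone W ∧ R < ‖η‖ := by
  simp [coneAbove]

theorem coneAbove_mono {W W' : Set (Sph d)} {R R' : ℝ} (h : W ⊆ W') (hR : R' ≤ R) :
    coneAbove W R ⊆ coneAbove W' R' := fun η hη => by
  rw [mem_coneAbove] at hη ⊢; exact ⟨cone_mono h hη.1, hR.trans_lt hη.2⟩

theorem Ko_mono {H : Subgroup (GL (Fin d) ℝ)} {W W' : Set (Sph d)} {V V' : Set (Rd d)} {R R' : ℝ}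
    (h : W ⊆ W') (hV : V ⊆ V') (hR : R' ≤ R) : Ko H W V R ⊆ Ko H W' V' R' := fun _ hη =>
  hη.mono (inter_subset_inter (image_mono hV) (coneAbove_mono h hR))

theorem mem_Ko_of_dualAct {H : Subgroup (GL (Fin d) ℝ)} {W : Set (Sph d)} {V : Set (Rd d)} {R : ℝ}
    {h : H} {η : Rd d} (hη : η ∈ coneAbove W R) (hV : dualAct (h : GL (Fin d) ℝ) η ∈ V) :
    h ∈ Ko H W V R :=
  ⟨η, ⟨_, hV, dualAct_inv_dualAct _ _⟩, hη⟩

/-- An invertible linear map sends small truncated cones into given truncated cones. -/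
theorem exists_dualAct_coneAbove {b : GL (Fin d) ℝ} {ξ ξ' : Sph d}
    (hb : dualAct b (ξ : Rd d) = ξ') {W : Set (Sph d)} (hW : IsOpen W) (hξ' : ξ' ∈ W) {R : ℝ}
    (hR : 0 < R) :
    ∃ W₁ : Set (Sph d), IsOpen W₁ ∧ ξ ∈ W₁ ∧ ∃ R₁ : ℝ, 0 < R₁ ∧
      ∀ η ∈ coneAbove W₁ R₁, dualAct b η ∈ coneAbove W R := by
  have hn := opNorm_nonneg b⁻¹
  refine ⟨{w | dualAct b (w : Rd d) ∈ cone W},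
    (isOpen_cone hW).preimage ((continuous_dualAct b).comp continuous_subtype_val), ?_,
    (opNorm b⁻¹ + 1) * R, by positivity, fun η hη => ?_⟩
  · change dualAct b (ξ : Rd d) ∈ cone W
    rw [hb]; exact coe_mem_cone hξ'
  · rw [mem_coneAbove] at hη ⊢
    obtain ⟨⟨w, hw, r, hr, rfl⟩, hlt⟩ := hη
    refine ⟨by rw [dualAct_smul]; exact smul_mem_cone hw hr, ?_⟩
    have h1 : ‖r • (w : Rd d)‖ ≤ opNorm b⁻¹ * ‖dualAct b (r • (w : Rd d))‖ := by
      conv_lhs => rw [← dualAct_inv_dualAct b (r • (w : Rd d))]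
      exact norm_dualAct_le _ _
    have h2 : (opNorm b⁻¹ + 1) * R < (opNorm b⁻¹ + 1) * ‖dualAct b (r • (w : Rd d))‖ := by
      refine (hlt.trans_le h1).trans_le ?_
      gcongr
      linarith
    exact lt_of_mul_lt_mul_left h2 (by positivity)

end Cones

/-! ### Open orbits -/

section Orbit

variable {d : ℕ} {H : Subgroup (GL (Fin d) ℝ)} {ξ₀ : Rd d}

theorem dualAct_mem_dualOrbit {h : GL (Fin d) ℝ} (hh : h ∈ H) {η : Rd d}
    (hη : η ∈ dualOrbit H ξ₀) : dualAct h η ∈ dualOrbit H ξ₀ := by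
  obtain ⟨g, hg, rfl⟩ := hη
  exact ⟨g * h, H.mul_mem hg hh, (dualAct_mul _ _ _).symm⟩

theorem exists_dualAct_eq {η σ : Rd d} (hη : η ∈ dualOrbit H ξ₀) (hσ : σ ∈ dualOrbit H ξ₀) :
    ∃ h ∈ H, dualAct h η = σ := by
  obtain ⟨g, hg, rfl⟩ := hη
  obtain ⟨k, hk, rfl⟩ := hσ
  exact ⟨g⁻¹ * k, H.mul_mem (H.inv_mem hg) hk, by rw [dualAct_mul, dualAct_inv_dualAct]⟩

theorem zero_notMem_dualOrbit {η : Rd d} (hη : η ∈ dualOrbit H ξ₀) (h0 : η ≠ 0) :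
    (0 : Rd d) ∉ dualOrbit H ξ₀ := fun h => by
  obtain ⟨g, -, hg⟩ := exists_dualAct_eq h hη
  exact h0 (by rw [← hg, dualAct_zero])

/-- Open orbits of the dual action are cones: the multiples `r • O` are open orbits, too, and
partition each ray. -/
theorem smul_mem_dualOrbit (hO : IsOpen (dualOrbit H ξ₀)) {ξ : Rd d} (hξ : ξ ∈ dualOrbit H ξ₀)
    {r : ℝ} (hr : 0 < r) : r • ξ ∈ dualOrbit H ξ₀ := by
  have : PreconnectedSpace (Ioi (0 : ℝ)) := Subtype.preconnectedSpace isPreconnected_Ioi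
  set A : Set (Ioi (0 : ℝ)) := {r | (r : ℝ) • ξ ∈ dualOrbit H ξ₀} with hA
  have hcont : Continuous fun r : Ioi (0 : ℝ) => (r : ℝ) • ξ := by fun_prop
  have hAo : IsOpen A := hO.preimage hcont
  -- For `s` outside `A` and `t` close to `s`, the vector `s⁻¹ t ξ` is in the orbit. If `t ξ` were
  -- too, some `g` would carry the first to the second; by linearity `g` then carries `ξ` to `s ξ`,
  -- a contradiction.
  have hAc : IsClosed A := by
    refine isOpen_compl_iff.1 (isOpen_iff_mem_nhds.2 fun s hs => ?_)
    have hs0 : (s : ℝ) ≠ 0 := (mem_Ioi.1 s.2).ne'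
    have hopen : IsOpen {t : Ioi (0 : ℝ) | (s : ℝ)⁻¹ • (t : ℝ) • ξ ∈ dualOrbit H ξ₀} :=
      hO.preimage (by fun_prop)
    refine Filter.mem_of_superset (hopen.mem_nhds (x := s) ?_) fun t ht hAt => hs ?_
    · simp only [mem_ofPred_eq, smul_smul, inv_mul_cancel₀ hs0, one_smul, hξ]
    · obtain ⟨g, hg, hge⟩ := exists_dualAct_eq ht hAt
      have ht0 : (t : ℝ) ≠ 0 := (mem_Ioi.1 t.2).ne'
      have h1 : dualAct g ((t : ℝ) • ξ) = (t : ℝ) • (s : ℝ) • ξ := by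
        rw [dualAct_smul] at hge
        have : (s : ℝ) • (s : ℝ)⁻¹ • dualAct g ((t : ℝ) • ξ) = (s : ℝ) • (t : ℝ) • ξ := by
          rw [hge]
        rw [smul_smul, mul_inv_cancel₀ hs0, one_smul] at this
        rw [this, smul_comm]
      have h2 : dualAct g ξ = (s : ℝ) • ξ := by
        rw [dualAct_smul] at h1
        exact smul_right_injective _ ht0 h1
      change (s : ℝ) • ξ ∈ dualOrbit H ξ₀
      rw [← h2]
      exact dualAct_mem_dualOrbit hg hξ
  have h1 : A = univ := IsClopen.eq_univ ⟨hAc, hAo⟩ ⟨⟨1, mem_Ioi.2 one_pos⟩, by simpa [hA] using hξ⟩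
  have h2 : (⟨r, hr⟩ : Ioi (0 : ℝ)) ∈ A := h1 ▸ mem_univ _
  exact h2

end Orbit

/-! ### Tame sets and transport along the orbit -/

section Tame

variable {d : ℕ} {H : Subgroup (GL (Fin d) ℝ)}

/-- The elements of `K` are bounded and their inverses grow at most polynomially in `‖h‖⁻¹`. -/
def Tame (K : Set H) : Prop :=
  ∃ (C : ℝ) (m : ℕ), 1 ≤ C ∧ ∀ h ∈ K, opNorm (h : GL (Fin d) ℝ) ≤ C ∧
    (1 + opNorm (h : GL (Fin d) ℝ)⁻¹) * opNorm (h : GL (Fin d) ℝ) ^ m ≤ C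

theorem Tame.mono {K K' : Set H} (hK : Tame K) (h : K' ⊆ K) : Tame K' := by
  obtain ⟨C, m, hC, hK⟩ := hK
  exact ⟨C, m, hC, fun g hg => hK g (h hg)⟩

/-- An element of the outer set moves a vector of the bounded set `V` beyond radius `R₀`, so `‖h⁻¹‖`
is bounded below; the estimate `‖h⁻¹‖ ≤ C ‖h‖^{-α}` turns this into an upper bound for `‖h‖`. -/
theorem tame_Ko_of_inverseNormEstimate {V : Set (Rd d)} {ξ : Sph d} (hV : Bornology.IsBounded V)
    (h : InverseNormEstimate H V ξ) :
    ∃ W₀ : Set (Sph d), IsOpen W₀ ∧ ξ ∈ W₀ ∧ ∃ R₀ : ℝ, 0 < R₀ ∧ Tame (Ko H W₀ V R₀) := by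
  obtain ⟨W₀, hW₀, hξ, R₀, hR₀, α, hα, C, hC, hest⟩ := h
  refine ⟨W₀, hW₀, hξ, R₀, hR₀, ?_⟩
  obtain ⟨D, hD0, hD⟩ := hV.exists_pos_norm_le
  set B : ℝ := max 1 ((C * D / R₀) ^ α⁻¹) with hB
  have hB1 : 1 ≤ B := le_max_left _ _
  have hkey : ∀ g ∈ Ko H W₀ V R₀, 0 < opNorm (g : GL (Fin d) ℝ) ∧
      opNorm (g : GL (Fin d) ℝ) ≤ B := by
    intro g hg
    obtain ⟨η, ⟨v, hv, rfl⟩, hη⟩ := id hg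
    have h1 := (mem_coneAbove.1 hη).2
    have h2 : R₀ < opNorm (g : GL (Fin d) ℝ)⁻¹ * D := h1.trans_le
      ((norm_dualAct_le _ _).trans
        (mul_le_mul_of_nonneg_left (hD v hv) (opNorm_nonneg _)))
    have h3 := hest g hg
    have ht0 := opNorm_nonneg (g : GL (Fin d) ℝ)
    have ht : 0 < opNorm (g : GL (Fin d) ℝ) := by
      refine lt_of_le_of_ne ht0 fun h0 => ?_
      have hv0 : v = 0 := by
        have := norm_dualAct_le (g : GL (Fin d) ℝ) (dualAct (g : GL (Fin d) ℝ)⁻¹ v)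
        rw [← h0, zero_mul, dualAct_dualAct_inv] at this
        exact norm_le_zero_iff.1 this
      rw [hv0, dualAct_zero, norm_zero] at h1
      exact absurd h1 (not_lt.2 hR₀.le)
    refine ⟨ht, le_max_of_le_right ?_⟩
    have h4 : R₀ < C * opNorm (g : GL (Fin d) ℝ) ^ (-α) * D := h2.trans_le (by gcongr)
    rw [Real.rpow_neg ht0] at h4
    have h5 : opNorm (g : GL (Fin d) ℝ) ^ α ≤ C * D / R₀ := by
      have hp : 0 < opNorm (g : GL (Fin d) ℝ) ^ α := Real.rpow_pos_of_pos ht _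
      rw [le_div_iff₀ hR₀]
      have := mul_lt_mul_of_pos_left h4 hp
      have e : opNorm (g : GL (Fin d) ℝ) ^ α *
          (C * (opNorm (g : GL (Fin d) ℝ) ^ α)⁻¹ * D) = C * D := by field_simp
      rw [e] at this
      exact this.le
    calc opNorm (g : GL (Fin d) ℝ) = (opNorm (g : GL (Fin d) ℝ) ^ α) ^ α⁻¹ := by
          rw [← Real.rpow_mul ht0, mul_inv_cancel₀ hα.ne', Real.rpow_one]
      _ ≤ _ := Real.rpow_le_rpow (by positivity) h5 (by positivity)
  -- Rounding up makes `m - α` nonnegative, so `‖h‖^{m-α}` stays bounded where `‖h‖` is.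
  set m := ⌈α⌉₊ with hm
  refine ⟨B + B ^ m + C * B ^ ((m : ℝ) - α), m, ?_, fun g hg => ?_⟩
  · have : 0 ≤ B ^ m + C * B ^ ((m : ℝ) - α) := by positivity
    linarith
  obtain ⟨ht, htB⟩ := hkey g hg
  set t := opNorm (g : GL (Fin d) ℝ) with htd
  have h1 : opNorm (g : GL (Fin d) ℝ)⁻¹ * t ^ m ≤ C * B ^ ((m : ℝ) - α) := by
    calc _ ≤ C * t ^ (-α) * t ^ m := by gcongr; exact hest g hg
      _ = C * t ^ ((m : ℝ) - α) := by
        rw [mul_assoc, ← Real.rpow_natCast t m, ← Real.rpow_add ht]; ring_nf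
      _ ≤ _ := by
        gcongr
        exact sub_nonneg.2 (Nat.le_ceil α)
  have h2 : t ^ m ≤ B ^ m := by gcongr
  constructor
  · have : 0 ≤ B ^ m + C * B ^ ((m : ℝ) - α) := by positivity
    linarith
  · rw [add_mul, one_mul]; linarith

/-- The norms of `h` and `b * h`, and of their inverses, agree up to factors depending on `b` alone.
-/
theorem Tame.preimage_mul_left {K : Set H} (hK : Tame K) (b : H) : Tame {h : H | b * h ∈ K} := by
  obtain ⟨C, m, hC, hK⟩ := hK
  set β := opNorm (b : GL (Fin d) ℝ) + 1 with hβ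
  set γ := opNorm (b : GL (Fin d) ℝ)⁻¹ + 1 with hγ
  have hβ1 : 1 ≤ β := by linarith [opNorm_nonneg (b : GL (Fin d) ℝ)]
  have hγ1 : 1 ≤ γ := by linarith [opNorm_nonneg (b : GL (Fin d) ℝ)⁻¹]
  have h1 : 1 ≤ β * γ ^ m := one_le_mul_of_one_le_of_one_le hβ1 (one_le_pow₀ hγ1)
  have h2 : 1 ≤ γ * (β * γ ^ m) := one_le_mul_of_one_le_of_one_le hγ1 h1
  refine ⟨γ * (β * γ ^ m) * C, m, one_le_mul_of_one_le_of_one_le h2 hC, fun h hh => ?_⟩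
  obtain ⟨e1, e2⟩ := hK (b * h) hh
  set g : GL (Fin d) ℝ := (b : GL (Fin d) ℝ) * (h : GL (Fin d) ℝ) with hg
  have e1' : opNorm g ≤ C := e1
  have e2' : (1 + opNorm g⁻¹) * opNorm g ^ m ≤ C := e2
  have f1 : opNorm (h : GL (Fin d) ℝ) ≤ γ * opNorm g := by
    have : (h : GL (Fin d) ℝ) = (b : GL (Fin d) ℝ)⁻¹ * g := by rw [hg, inv_mul_cancel_left]
    conv_lhs => rw [this]
    refine (opNorm_mul_le _ _).trans ?_
    have := opNorm_nonneg g
    gcongr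
    linarith
  have f2 : 1 + opNorm (h : GL (Fin d) ℝ)⁻¹ ≤ β * (1 + opNorm g⁻¹) := by
    have e : (h : GL (Fin d) ℝ)⁻¹ = g⁻¹ * (b : GL (Fin d) ℝ) := by
      rw [hg, mul_inv_rev, inv_mul_cancel_right]
    rw [e]
    have := opNorm_mul_le g⁻¹ (b : GL (Fin d) ℝ)
    nlinarith [opNorm_nonneg g⁻¹, opNorm_nonneg (b : GL (Fin d) ℝ)]
  have hg0 := opNorm_nonneg g
  have hgi := opNorm_nonneg g⁻¹
  constructor
  · calc _ ≤ γ * opNorm g := f1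
      _ ≤ γ * C := by gcongr
      _ ≤ γ * (β * γ ^ m) * C := by
        gcongr
        exact le_mul_of_one_le_right (by linarith) h1
  · calc (1 + opNorm (h : GL (Fin d) ℝ)⁻¹) * opNorm (h : GL (Fin d) ℝ) ^ m
        ≤ (β * (1 + opNorm g⁻¹)) * (γ * opNorm g) ^ m := by
          have := opNorm_nonneg (h : GL (Fin d) ℝ)
          gcongr
      _ = β * γ ^ m * ((1 + opNorm g⁻¹) * opNorm g ^ m) := by rw [mul_pow]; ring
      _ ≤ β * γ ^ m * C := by gcongr
      _ ≤ _ := mul_le_mul_of_nonneg_right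
        (le_mul_of_one_le_left (zero_le_one.trans h1) hγ1) (zero_le_one.trans hC)

/-- Powers of `‖h‖` absorb powers of `1 + ‖h⁻¹‖` on tame sets. -/
theorem pow_mul_pow_le {C : ℝ} {m : ℕ} {h : GL (Fin d) ℝ}
    (hh : (1 + opNorm h⁻¹) * opNorm h ^ m ≤ C) (N j : ℕ) :
    opNorm h ^ (N + m * j) * (1 + opNorm h⁻¹) ^ j ≤ C ^ j * opNorm h ^ N := by
  have h0 := opNorm_nonneg h
  have h1 := opNorm_nonneg h⁻¹
  calc _ = ((1 + opNorm h⁻¹) * opNorm h ^ m) ^ j * opNorm h ^ N := by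
        rw [pow_add, pow_mul, mul_pow]; ring
    _ ≤ _ := by gcongr

variable {ξ₀ : Rd d}

/-- Left translation transports the outer sets between points of the orbit. -/
theorem exists_Ko_subset_preimage {ξ ξ' : Sph d} {b : H}
    (hb : dualAct (b : GL (Fin d) ℝ) (ξ : Rd d) = ξ') {W : Set (Sph d)} (hW : IsOpen W)
    (hξ : ξ ∈ W) {R : ℝ} (hR : 0 < R) :
    ∃ W' : Set (Sph d), IsOpen W' ∧ ξ' ∈ W' ∧ ∃ R' : ℝ, 0 < R' ∧
      ∀ V : Set (Rd d), Ko H W' V R' ⊆ {h : H | b * h ∈ Ko H W V R} := by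
  have hb' : dualAct (b : GL (Fin d) ℝ)⁻¹ (ξ' : Rd d) = ξ := by
    rw [← hb, dualAct_inv_dualAct]
  obtain ⟨W', hW', hξ', R', hR', h⟩ := exists_dualAct_coneAbove hb' hW hξ hR
  refine ⟨W', hW', hξ', R', hR', fun V g hg => ?_⟩
  obtain ⟨η, ⟨v, hv, rfl⟩, hη⟩ := hg
  refine ⟨_, ⟨v, hv, rfl⟩, ?_⟩
  have e : (((b * g : H) : GL (Fin d) ℝ))⁻¹ = (g : GL (Fin d) ℝ)⁻¹ * (b : GL (Fin d) ℝ)⁻¹ := by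
    rw [Subgroup.coe_mul, mul_inv_rev]
  rw [e, dualAct_mul]
  exact h _ hη

theorem exists_tame_Ko {V : Set (Rd d)} (hV : Bornology.IsBounded V) {ξ ξ' : Sph d}
    (hξ : (ξ : Rd d) ∈ dualOrbit H ξ₀) (hξ' : (ξ' : Rd d) ∈ dualOrbit H ξ₀)
    (h : InverseNormEstimate H V ξ) :
    ∃ W₀ : Set (Sph d), IsOpen W₀ ∧ ξ' ∈ W₀ ∧ ∃ R₀ : ℝ, 0 < R₀ ∧ Tame (Ko H W₀ V R₀) := by
  obtain ⟨W, hW, hξW, R, hR, hT⟩ := tame_Ko_of_inverseNormEstimate hV h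
  obtain ⟨b, hbH, hb⟩ := exists_dualAct_eq hξ hξ'
  obtain ⟨W', hW', hξ'W, R', hR', hs⟩ :=
    exists_Ko_subset_preimage (b := ⟨b, hbH⟩) hb hW hξW hR
  exact ⟨W', hW', hξ'W, R', hR', (hT.preimage_mul_left ⟨b, hbH⟩).mono (hs V)⟩

/-- Choose `b` in `H` carrying `ξ` to `ξ'`. Left translation by `b` carries outer sets at `ξ'` into
outer sets at `ξ`; applying the dual action of `b` then returns the resulting cone inclusion to
`ξ'`. -/
theorem WeakConeApprox.transport {V : ℕ → Set (Rd d)} {ξ ξ' : Sph d}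
    (hξ : (ξ : Rd d) ∈ dualOrbit H ξ₀) (hξ' : (ξ' : Rd d) ∈ dualOrbit H ξ₀)
    (h : WeakConeApprox H V ξ) : WeakConeApprox H V ξ' := by
  intro W hW hξW R hR
  obtain ⟨b, hbH, hb⟩ := exists_dualAct_eq hξ hξ'
  obtain ⟨W₁, hW₁, hξW₁, R₁, hR₁, h₁⟩ := exists_dualAct_coneAbove hb hW hξW hR
  obtain ⟨n, R₂, hR₂, W₂, hW₂, hξW₂, h₂⟩ := h W₁ hW₁ hξW₁ R₁ hR₁
  obtain ⟨W', hW', hξ'W, R', hR', hs⟩ :=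
    exists_Ko_subset_preimage (b := ⟨b, hbH⟩) hb hW₂ hξW₂ hR₂
  refine ⟨n, R', hR', W', hW', hξ'W, fun g hg => ?_⟩
  have h3 := h₂ (hs (V n) hg)
  rintro _ ⟨v, hv, rfl⟩
  have h4 := h₁ _ (h3 ⟨v, hv, rfl⟩)
  have e : ((((⟨b, hbH⟩ : H) * g : H) : GL (Fin d) ℝ))⁻¹ = (g : GL (Fin d) ℝ)⁻¹ * b⁻¹ := by
    rw [Subgroup.coe_mul, mul_inv_rev]
  rwa [e, dualAct_mul, dualAct_dualAct_inv] at h4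

end Tame

/-! ### Fourier transforms of wavelets -/

section Wavelets

variable {d : ℕ}

theorem det_linEquiv (h : GL (Fin d) ℝ) :
    (linEquiv h : Rd d →L[ℝ] Rd d).det = (h : Matrix (Fin d) (Fin d) ℝ).det := by
  have h1 : ((linEquiv h : Rd d →L[ℝ] Rd d) : Rd d →ₗ[ℝ] Rd d) =
      Matrix.toLpLin 2 2 (h : Matrix (Fin d) (Fin d) ℝ) :=
    Matrix.coe_toEuclideanCLM_eq_toEuclideanLin (n := Fin d) (𝕜 := ℝ) _
  rw [ContinuousLinearMap.det, h1, Matrix.toLpLin_eq_toLin, LinearMap.det_toLin]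

theorem integral_eq_integral_comp_affine (h : GL (Fin d) ℝ) (y : Rd d) (f : Rd d → ℂ) :
    ∫ z, f z = ((|(h : Matrix (Fin d) (Fin d) ℝ).det| : ℝ) : ℂ) *
      ∫ w, f (linEquiv h w + y) := by
  have himg : (fun w => linEquiv h w + y) '' univ = univ := by
    rw [image_univ, range_eq_univ]
    intro z
    exact ⟨linEquiv h⁻¹ (z - y), by simp [linEquiv_linEquiv_inv]⟩
  have key := integral_image_eq_integral_abs_det_fderiv_smul (μ := volume) (s := univ)
    (f := fun w => linEquiv h w + y) (f' := fun _ => (linEquiv h : Rd d →L[ℝ] Rd d))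
    MeasurableSet.univ
    (fun w _ => ((linEquiv h).hasFDerivAt.add_const y).hasFDerivWithinAt)
    ((add_left_injective y).comp (linEquiv h).injective).injOn f
  rw [himg, setIntegral_univ, setIntegral_univ] at key
  rw [key, det_linEquiv, ← integral_const_mul]
  rfl

theorem quasiRegular_eq (y : Rd d) (h : GL (Fin d) ℝ) (f : 𝓢(Rd d, ℂ)) (z : Rd d) :
    quasiRegular y h f z = (detFactor h : ℂ) * f (linEquiv h⁻¹ (z - y)) :=
  quasiRegular_apply y h f z

theorem conjSchwartz_quasiRegular (y : Rd d) (h : GL (Fin d) ℝ) (f : 𝓢(Rd d, ℂ)) :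
    conjSchwartz (quasiRegular y h f) = quasiRegular y h (conjSchwartz f) := by
  ext z
  rw [conjSchwartz_apply, quasiRegular_eq, quasiRegular_eq, conjSchwartz_apply, map_mul,
    Complex.conj_ofReal]

theorem fourier_eq_integral_chr (f : 𝓢(Rd d, ℂ)) (ζ : Rd d) :
    (𝓕 f) ζ = ∫ z, chr ζ z * f z := by
  rw [SchwartzMap.fourier_coe, Real.fourier_eq]
  refine integral_congr_ae (Filter.Eventually.of_forall fun z => ?_)
  simp only [chr_eq_fourierChar, Circle.smul_def, smul_eq_mul, real_inner_comm]

theorem fourierInv_apply_neg (f : 𝓢(Rd d, ℂ)) (ζ : Rd d) : (𝓕⁻ f) ζ = (𝓕 f) (-ζ) := by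
  rw [SchwartzMap.fourierInv_coe, SchwartzMap.fourier_coe, Real.fourierInv_eq_fourier_neg]

/-- Substituting `z = h w + y` gives the Jacobian `|det h|`, which with the normalizing factor
leaves `|det h|^{1/2}`. -/
theorem fourier_quasiRegular (y : Rd d) (h : GL (Fin d) ℝ) (f : 𝓢(Rd d, ℂ)) (ζ : Rd d) :
    (𝓕 (quasiRegular y h f)) ζ =
      chr y ζ * (((detFactor h)⁻¹ : ℝ) * (𝓕 f) (dualAct h ζ)) := by
  have h1 : ((detFactor h)⁻¹ : ℝ) = |(h : Matrix (Fin d) (Fin d) ℝ).det| * detFactor h := by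
    have h2 := detFactor_sq h
    have h3 := (detFactor_pos h).ne'
    have h4 := (abs_det_pos h).ne'
    field_simp at h2 ⊢
    rw [pow_two]; linarith
  have h2 : ∫ w, chr ζ (linEquiv h w + y) * quasiRegular y h f (linEquiv h w + y) =
      chr y ζ * detFactor h * ∫ w, chr (dualAct h ζ) w * f w := by
    rw [← integral_const_mul]
    refine integral_congr_ae (Filter.Eventually.of_forall fun w => ?_)
    simp only [quasiRegular_eq, add_sub_cancel_right, linEquiv_inv_linEquiv]
    have h3 : chr ζ (linEquiv h w + y) = chr y ζ * chr (dualAct h ζ) w := by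
      simp only [chr, ← Complex.exp_add]
      congr 1
      rw [inner_add_right, real_inner_comm (linEquiv h w), ← inner_dualAct, real_inner_comm ζ y,
        real_inner_comm (dualAct h ζ) w]
      push_cast; ring
    rw [h3]; ring
  rw [fourier_eq_integral_chr, integral_eq_integral_comp_affine h y, h2,
    fourier_eq_integral_chr, h1]
  push_cast
  ring

/-- Translation becomes modulation: this is the form in which `clm_mul_fourier_eq_integral` yields
the wavelets centered at every `y`. -/
theorem quasiRegular_fourier (y : Rd d) (h : GL (Fin d) ℝ) (f : 𝓢(Rd d, ℂ)) :
    𝓕 (quasiRegular y h f) = modS y (𝓕 (quasiRegular 0 h f)) := by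
  ext ζ
  rw [modS_apply, fourier_quasiRegular, fourier_quasiRegular]
  simp [chr]

theorem fourier_conjSchwartz (f : 𝓢(Rd d, ℂ)) (ζ : Rd d) :
    (𝓕 (conjSchwartz f)) (-ζ) = conj ((𝓕 f) ζ) := by
  rw [fourier_eq_integral_chr, fourier_eq_integral_chr, ← integral_conj]
  refine integral_congr_ae (Filter.Eventually.of_forall fun z => ?_)
  simp only [conjSchwartz_apply, map_mul]
  congr 1
  rw [chr, chr, ← Complex.exp_conj, inner_neg_left]
  congr 1
  simp [map_ofNat]

theorem norm_fourierInv_quasiRegular (y : Rd d) (h : GL (Fin d) ℝ) (f : 𝓢(Rd d, ℂ)) (η : Rd d) :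
    ‖(𝓕⁻ (quasiRegular y h f)) η‖ = (detFactor h)⁻¹ * ‖(𝓕 f) (-dualAct h η)‖ := by
  rw [fourierInv_apply_neg, fourier_quasiRegular, norm_mul, norm_chr, one_mul, norm_mul,
    Complex.norm_real, Real.norm_of_nonneg (inv_nonneg.2 (detFactor_pos h).le), dualAct_neg]

end Wavelets

/-! ### Gaining powers of a norm from a cutoff -/

section Cutoff

variable {d : ℕ}

/-- If `a` vanishes near the origin, then multiplication with `a ∘ A` makes a Schwartz function
as small as any power of `‖A‖`. -/
theorem exists_seminorm_cutoff_le (N k l : ℕ) (f : 𝓢(Rd d, ℂ)) {ε : ℝ} (hε : 0 < ε) {B T : ℝ}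
    (hB : 0 ≤ B) (hT : 0 ≤ T) :
    ∃ C : ℝ, ∀ (a : Rd d → ℂ) (A : Rd d →L[ℝ] Rd d) (F : 𝓢(Rd d, ℂ)), ContDiff ℝ ∞ a →
      (∀ j ≤ l, ∀ z, ‖iteratedFDeriv ℝ j a z‖ ≤ B) → (∀ z, ‖z‖ < ε → a z = 0) → ‖A‖ ≤ T →
      (∀ ζ, F ζ = a (A ζ) * f ζ) → SchwartzMap.seminorm ℂ k l F ≤ C * ‖A‖ ^ N := by
  refine ⟨2 ^ l * 2 ^ (k + N) *
      (Finset.Iic (k + N, l)).sup (schwartzSeminormFamily ℂ (Rd d) ℂ) f *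
      (B * (1 + T) ^ l * (ε⁻¹) ^ N), fun a A F ha haB ha0 hAT hF => ?_⟩
  have hA := norm_nonneg A
  refine (seminorm_mul_le k l N (fun ζ => a (A ζ)) f F (B := B * (1 + T) ^ l * (ε⁻¹) ^ N * ‖A‖ ^ N)
    (ha.comp A.contDiff) (by positivity) (fun j hj ζ => ?_) hF).trans (le_of_eq (by ring))
  have e1 : iteratedFDeriv ℝ j (fun ζ => a (A ζ)) ζ =
      (iteratedFDeriv ℝ j a (A ζ)).compContinuousLinearMap fun _ => A :=
    A.iteratedFDeriv_comp_right (n := ∞) ha ζ (mod_cast le_top)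
  rw [e1]
  refine (ContinuousMultilinearMap.norm_compContinuousLinearMap_le _ _).trans ?_
  rw [Finset.prod_const, Finset.card_univ, Fintype.card_fin]
  rcases lt_or_ge ‖A ζ‖ ε with h | h
  · have h0 : a =ᶠ[𝓝 (A ζ)] fun _ => 0 := by
      filter_upwards [(isOpen_lt continuous_norm continuous_const).mem_nhds h] with z hz
      exact ha0 z hz
    rw [(h0.iteratedFDeriv ℝ j).eq_of_nhds]
    have : iteratedFDeriv ℝ j (fun _ : Rd d => (0 : ℂ)) (A ζ) = 0 := by
      simp
    rw [this, norm_zero, zero_mul]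
    positivity
  · have h1 : 1 ≤ ε⁻¹ * (‖A‖ * (1 + ‖ζ‖)) := by
      rw [← div_eq_inv_mul, one_le_div hε]
      refine h.trans ((A.le_opNorm ζ).trans ?_)
      gcongr
      linarith
    have h2 : ‖A‖ ^ j ≤ (1 + T) ^ l :=
      (pow_le_pow_left₀ hA (by linarith) j).trans (pow_le_pow_right₀ (by linarith) hj)
    calc _ ≤ B * (1 + T) ^ l := mul_le_mul (haB j hj _) h2 (by positivity) hB
      _ ≤ B * (1 + T) ^ l * (ε⁻¹ * (‖A‖ * (1 + ‖ζ‖))) ^ N :=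
        le_mul_of_one_le_right (by positivity) (one_le_pow₀ h1)
      _ = _ := by rw [mul_pow, mul_pow]; ring

theorem exists_bound_iteratedFDeriv_one_sub {φ : Rd d → ℂ} (hφ : ContDiff ℝ ∞ φ)
    (hc : HasCompactSupport φ) (l : ℕ) :
    ∃ B : ℝ, 0 ≤ B ∧ ∀ j ≤ l, ∀ z, ‖iteratedFDeriv ℝ j (fun z => 1 - φ z) z‖ ≤ B := by
  have hj : ∀ j : ℕ, ∃ B : ℝ, ∀ z, ‖iteratedFDeriv ℝ j (fun z => 1 - φ z) z‖ ≤ B := by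
    intro j
    have hcont : Continuous (iteratedFDeriv ℝ j φ) :=
      hφ.continuous_iteratedFDeriv (mod_cast le_top)
    obtain ⟨B, hB⟩ := hcont.bounded_above_of_compact_support (hc.iteratedFDeriv j)
    refine ⟨1 + B, fun z => ?_⟩
    have e : iteratedFDeriv ℝ j (fun z => 1 - φ z) z =
        iteratedFDeriv ℝ j (fun _ : Rd d => (1 : ℂ)) z - iteratedFDeriv ℝ j φ z :=
      iteratedFDeriv_sub_apply contDiff_const.contDiffAt
        (hφ.of_le (mod_cast le_top)).contDiffAt
    rw [e]
    refine (norm_sub_le _ _).trans (add_le_add ?_ (hB z))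
    rcases eq_or_ne j 0 with rfl | h0
    · simp
    · rw [iteratedFDeriv_const_of_ne h0]; simp
  choose B hB using hj
  refine ⟨∑ j ∈ Finset.range (l + 1), |B j|, by positivity, fun j hj z => ?_⟩
  exact (hB j z).trans ((le_abs_self _).trans (Finset.single_le_sum (f := fun j => |B j|)
    (fun _ _ => abs_nonneg _) (Finset.mem_range.2 (Nat.lt_succ_iff.2 hj))))

end Cutoff

/-! ### Regular directed points give rapidly decaying coefficients -/

section Direct

variable {d : ℕ} {H : Subgroup (GL (Fin d) ℝ)}

theorem integrable_inv_one_add_norm_pow :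
    Integrable fun η : Rd d => ((1 + ‖η‖) ^ (d + 1))⁻¹ := by
  have h := integrable_one_add_norm (E := Rd d) (μ := volume) (r := ((d + 1 : ℕ) : ℝ))
    (by rw [finrank_euclideanSpace_fin]; exact_mod_cast d.lt_succ_self)
  refine h.congr (Filter.Eventually.of_forall fun η => ?_)
  simp only
  rw [Real.rpow_neg (by positivity), Real.rpow_natCast]

/-- Rapid decay of a function on a cone controls its pairing with wavelets whose frequency support
lies in that cone. -/
theorem exists_norm_integral_fourierInv_quasiRegular_le {K : Set H} (hK : Tame K) {W : Set (Sph d)}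
    {V : Set (Rd d)} {c : ℝ} (hc : 0 < c) (hVc : ∀ v ∈ V, c ≤ ‖v‖)
    (hKW : ∀ h ∈ K, ∀ v ∈ V, dualAct (h : GL (Fin d) ℝ)⁻¹ v ∈ cone W) {g : Rd d → ℂ}
    (hg : ∀ N : ℕ, ∃ C : ℝ, 0 < C ∧ ∀ η ∈ cone W, ‖g η‖ ≤ C * ((1 + ‖η‖) ^ N)⁻¹)
    (f : 𝓢(Rd d, ℂ)) (hf : ∀ σ, σ ∉ V → (𝓕 f) (-σ) = 0) (N : ℕ) :
    ∃ C : ℝ, ∀ y, ∀ h ∈ K, ‖∫ η, (𝓕⁻ (quasiRegular y (h : GL (Fin d) ℝ) f)) η • g η‖ ≤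
      C * opNorm (h : GL (Fin d) ℝ) ^ N := by
  obtain ⟨C, m, hC1, hK⟩ := hK
  -- `N` powers are converted into powers of `‖h‖`; the other `d + 1` make the integral converge.
  obtain ⟨D, hD, hgD⟩ := hg (N + (d + 1))
  set S := SchwartzMap.seminorm ℂ 0 0 (𝓕 f) with hS
  have hS0 : 0 ≤ S := apply_nonneg _ _
  refine ⟨(1 + d.factorial * C ^ d) * S * D * (c⁻¹) ^ N *
    ∫ η : Rd d, ((1 + ‖η‖) ^ (d + 1))⁻¹, fun y h hh => ?_⟩
  set t := opNorm (h : GL (Fin d) ℝ) with ht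
  have ht0 : 0 ≤ t := opNorm_nonneg _
  have htC : t ≤ C := (hK h hh).1
  have hδ : (detFactor (h : GL (Fin d) ℝ))⁻¹ ≤ 1 + d.factorial * C ^ d :=
    (inv_detFactor_le _).trans (by gcongr)
  have hδ0 : 0 ≤ (detFactor (h : GL (Fin d) ℝ))⁻¹ := inv_nonneg.2 (detFactor_pos _).le
  have key : ∀ η, ‖(𝓕⁻ (quasiRegular y (h : GL (Fin d) ℝ) f)) η • g η‖ ≤
      ((1 + d.factorial * C ^ d) * S * D * (c⁻¹) ^ N * t ^ N) * ((1 + ‖η‖) ^ (d + 1))⁻¹ := by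
    intro η
    rw [norm_smul, norm_fourierInv_quasiRegular]
    by_cases hV : dualAct (h : GL (Fin d) ℝ) η ∈ V
    · have h1 : η ∈ cone W := by
        have := hKW h hh _ hV
        rwa [dualAct_inv_dualAct] at this
      have h2 : c ≤ t * (1 + ‖η‖) := (hVc _ hV).trans
        ((norm_dualAct_le _ _).trans (by gcongr; linarith))
      have h3 : ((1 + ‖η‖) ^ N)⁻¹ ≤ (c⁻¹) ^ N * t ^ N := by
        rw [← mul_pow, ← inv_pow]
        refine pow_le_pow_left₀ (by positivity) ?_ N
        rw [← div_eq_inv_mul, le_div_iff₀ hc, ← div_eq_inv_mul, div_le_iff₀ (by positivity)]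
        exact h2
      calc _ ≤ ((1 + d.factorial * C ^ d) * S) * (D * ((1 + ‖η‖) ^ (N + (d + 1)))⁻¹) := by
            refine mul_le_mul (mul_le_mul hδ ?_ (norm_nonneg _) (by positivity)) (hgD η h1)
              (norm_nonneg _) (by positivity)
            exact SchwartzMap.norm_le_seminorm ℂ (𝓕 f) _
        _ = ((1 + d.factorial * C ^ d) * S * D) * ((1 + ‖η‖) ^ N)⁻¹ *
            ((1 + ‖η‖) ^ (d + 1))⁻¹ := by rw [pow_add, mul_inv]; ring
        _ ≤ ((1 + d.factorial * C ^ d) * S * D) * ((c⁻¹) ^ N * t ^ N) *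
            ((1 + ‖η‖) ^ (d + 1))⁻¹ := by gcongr
        _ = _ := by ring
    · rw [hf _ hV, norm_zero, mul_zero, zero_mul]
      positivity
  refine (norm_integral_le_of_norm_le (integrable_inv_one_add_norm_pow.const_mul _)
    (Filter.Eventually.of_forall key)).trans (le_of_eq ?_)
  rw [integral_const_mul]; ring

/-- The part of a wavelet away from its center is rapidly small. -/
theorem exists_norm_away_le {K : Set H} (hK : Tame K) (u : 𝓢(Rd d, ℂ) →L[ℂ] ℂ) {φ : Rd d → ℂ}
    (hφ : ContDiff ℝ ∞ φ) (hφc : HasCompactSupport φ) {x : Rd d} {ε : ℝ} (hε : 0 < ε)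
    (hφ1 : ∀ y ∈ Metric.ball x (2 * ε), φ y = 1) (f : 𝓢(Rd d, ℂ)) (N : ℕ) :
    ∃ C : ℝ, ∀ y ∈ Metric.ball x ε, ∀ h ∈ K, ‖u (quasiRegular y (h : GL (Fin d) ℝ) f -
      SchwartzMap.smulLeftCLM ℂ φ (quasiRegular y (h : GL (Fin d) ℝ) f))‖ ≤
        C * opNorm (h : GL (Fin d) ℝ) ^ N := by
  obtain ⟨C, m, hC1, hK⟩ := hK
  have hφg : φ.HasTemperateGrowth := hφc.hasTemperateGrowth hφ
  set F : Rd d × H → 𝓢(Rd d, ℂ) := fun i => quasiRegular i.1 (i.2 : GL (Fin d) ℝ) f -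
      SchwartzMap.smulLeftCLM ℂ φ (quasiRegular i.1 (i.2 : GL (Fin d) ℝ) f) with hF
  set s : Set (Rd d × H) := Metric.ball x ε ×ˢ K with hs
  have hFa : ∀ i z, F i z = (1 - φ z) * (detFactor (i.2 : GL (Fin d) ℝ) *
      f (linEquiv (i.2 : GL (Fin d) ℝ)⁻¹ (z - i.1))) := fun i z => by
    rw [← quasiRegular_eq]
    simp only [hF, sub_apply, SchwartzMap.smulLeftCLM_apply_apply hφg, smul_eq_mul]
    ring
  -- The remainder in the wavelet's own coordinates: `φ = 1` on the ball of radius `2ε` and `y` lies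
  -- within `ε` of `x`, so it vanishes when `‖h w‖ < ε`.
  set F₁ : Rd d × H → 𝓢(Rd d, ℂ) := fun i => SchwartzMap.compCLMOfContinuousLinearEquiv ℂ
    (linEquiv (i.2 : GL (Fin d) ℝ)) (SchwartzMap.compSubConstCLM ℂ (-i.1) (F i)) with hF₁
  have hF₁a : ∀ i w, F₁ i w = (1 - φ (linEquiv (i.2 : GL (Fin d) ℝ) w + i.1)) *
      (detFactor (i.2 : GL (Fin d) ℝ) * f w) := fun i w => by
    simp only [hF₁, SchwartzMap.compCLMOfContinuousLinearEquiv_apply, Function.comp_apply,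
      SchwartzMap.compSubConstCLM_apply, sub_neg_eq_add, hFa, add_sub_cancel_right,
      linEquiv_inv_linEquiv]
  set w : ℕ → Rd d × H → ℝ := fun N i => opNorm (i.2 : GL (Fin d) ℝ) ^ N with hw
  have hw0 : ∀ N i, 0 ≤ w N i := fun N i => pow_nonneg (opNorm_nonneg _) _
  have hT1 : ∀ (N k l : ℕ), ∃ D : ℝ, ∀ i ∈ s,
      SchwartzMap.seminorm ℂ k l (F₁ i) ≤ D * (detFactor (i.2 : GL (Fin d) ℝ) * w N i) := by
    intro N k l
    obtain ⟨B, hB, hBφ⟩ := exists_bound_iteratedFDeriv_one_sub hφ hφc l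
    obtain ⟨D, hD⟩ := exists_seminorm_cutoff_le N k l f hε hB (zero_le_one.trans hC1)
    refine ⟨D, fun i hi => ?_⟩
    have hδ := detFactor_pos (i.2 : GL (Fin d) ℝ)
    set F₂ : 𝓢(Rd d, ℂ) := ((detFactor (i.2 : GL (Fin d) ℝ) : ℂ)⁻¹) • F₁ i with hF₂
    have h1 : F₁ i = (detFactor (i.2 : GL (Fin d) ℝ) : ℂ) • F₂ := by
      rw [hF₂, smul_smul, mul_inv_cancel₀ (by exact_mod_cast hδ.ne'), one_smul]
    rw [h1, map_smul_eq_mul, Complex.norm_real, Real.norm_of_nonneg hδ.le, mul_left_comm]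
    refine mul_le_mul_of_nonneg_left ?_ hδ.le
    refine hD (fun z => 1 - φ (z + i.1)) (linEquiv (i.2 : GL (Fin d) ℝ) : Rd d →L[ℝ] Rd d) F₂
      (contDiff_const.sub (hφ.comp (contDiff_id.add contDiff_const))) (fun j hj z => ?_)
      (fun z hz => ?_) (hK _ hi.2).1 (fun ζ => ?_)
    · rw [iteratedFDeriv_comp_add_right (f := fun z => 1 - φ z)]
      exact hBφ j hj _
    · rw [hφ1 _ ?_, sub_self]
      have := Metric.mem_ball.1 hi.1
      rw [Metric.mem_ball, dist_eq_norm]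
      calc ‖z + i.1 - x‖ = ‖z + (i.1 - x)‖ := by rw [add_sub_assoc]
        _ ≤ ‖z‖ + ‖i.1 - x‖ := norm_add_le _ _
        _ < 2 * ε := by rw [dist_eq_norm] at this; linarith
    · have hδ' : (detFactor (i.2 : GL (Fin d) ℝ) : ℂ) ≠ 0 := by exact_mod_cast hδ.ne'
      rw [hF₂, smul_apply, hF₁a, smul_eq_mul]
      change _ = (1 - φ (linEquiv (i.2 : GL (Fin d) ℝ) ζ + i.1)) * f ζ
      field_simp
  obtain ⟨D, -, hD⟩ := norm_le_of_seminorm_le u s F (w N) (fun i _ => hw0 N i) (fun k l => by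
    -- Returning to the original coordinates costs `l` powers of `1 + ‖h⁻¹‖` for the derivatives and
    -- `d` for the determinant; each costs `m` powers of `‖h‖`.
    set N' := N + m * (l + d) with hN'
    obtain ⟨D, hD0, hD⟩ := sup_seminorm_le s F₁ (fun i => detFactor (i.2 : GL (Fin d) ℝ) * w N' i)
      (fun i _ => mul_nonneg (detFactor_pos _).le (hw0 _ i)) (hT1 N') (Finset.Iic (k, l))
    refine ⟨(C + (‖x‖ + ε)) ^ k * (2 ^ k * D) * (1 + d.factorial) * C ^ (l + d), fun i hi => ?_⟩
    obtain ⟨hKC, hKm⟩ := hK _ hi.2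
    set h : GL (Fin d) ℝ := (i.2 : GL (Fin d) ℝ) with hh
    have hi1 : ‖i.1‖ ≤ ‖x‖ + ε := by
      have h1 : dist i.1 x < ε := hi.1
      rw [dist_eq_norm] at h1
      have h2 : i.1 = x + (i.1 - x) := by abel
      rw [h2]
      exact (norm_add_le _ _).trans (by linarith)
    have hn := opNorm_nonneg h⁻¹
    have hpull := seminorm_comp_affine_le k l (linEquiv h⁻¹) i.1 (F₁ i) (F i) (fun z => by
      rw [hF₁a, hFa, ← hh, linEquiv_linEquiv_inv, sub_add_cancel])
    rw [linEquiv_inv_symm, norm_linEquiv, norm_linEquiv] at hpull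
    have hw' : w N' i = opNorm h ^ N' := rfl
    have hδ := detFactor_le h
    have hδ0 := detFactor_pos h
    have ht0 := opNorm_nonneg h
    have h0 : 0 ≤ 1 + opNorm h⁻¹ := by linarith
    calc SchwartzMap.seminorm ℂ k l (F i) ≤ _ := hpull
      _ ≤ (1 + opNorm h⁻¹) ^ l * (C + (‖x‖ + ε)) ^ k * (2 ^ k *
          (D * ((1 + d.factorial) * (1 + opNorm h⁻¹) ^ d * opNorm h ^ N'))) := by
        refine mul_le_mul (mul_le_mul ?_ ?_ (by positivity) (by positivity)) ?_ (by positivity)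
          (by positivity)
        · exact pow_le_pow_left₀ hn (by linarith) _
        · exact pow_le_pow_left₀ (by positivity) (add_le_add hKC hi1) _
        · refine mul_le_mul_of_nonneg_left ((hD i hi).trans ?_) (by positivity)
          refine mul_le_mul_of_nonneg_left ?_ hD0
          exact mul_le_mul_of_nonneg_right hδ (by positivity)
      _ = (C + (‖x‖ + ε)) ^ k * (2 ^ k * D) * (1 + d.factorial) *
          (opNorm h ^ N' * (1 + opNorm h⁻¹) ^ (l + d)) := by rw [pow_add _ l d]; ring
      _ ≤ (C + (‖x‖ + ε)) ^ k * (2 ^ k * D) * (1 + d.factorial) *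
          (C ^ (l + d) * opNorm h ^ N) := by
        refine mul_le_mul_of_nonneg_left (pow_mul_pow_le hKm N (l + d)) ?_
        positivity
      _ = _ := by simp only [hw]; ring)
  exact ⟨D, fun y hy h hh => hD (y, h) ⟨hy, hh⟩⟩

/-- The tempered distribution as a continuous linear map. -/
noncomputable def distCLM (u : 𝓢'(Rd d, ℂ)) : 𝓢(Rd d, ℂ) →L[ℂ] ℂ :=
  ⟨(u : 𝓢(Rd d, ℂ) →ₗ[ℂ] ℂ), u.continuous⟩

theorem distCLM_apply (u : 𝓢'(Rd d, ℂ)) (f : 𝓢(Rd d, ℂ)) : distCLM u f = u f := rfl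

theorem waveletTransform_eq (ψ : 𝓢(Rd d, ℂ)) (u : 𝓢'(Rd d, ℂ)) (y : Rd d) (h : GL (Fin d) ℝ) :
    waveletTransform ψ u y h = u (quasiRegular y h (conjSchwartz ψ)) := by
  rw [waveletTransform, conjSchwartz_quasiRegular]

theorem exists_pos_le_norm_of_closure_subset {V O : Set (Rd d)} (hV : closure V ⊆ O)
    (h0 : (0 : Rd d) ∉ O) : ∃ c : ℝ, 0 < c ∧ ∀ v ∈ V, c ≤ ‖v‖ := by
  have h1 : (closure V)ᶜ ∈ 𝓝 (0 : Rd d) := isClosed_closure.isOpen_compl.mem_nhds fun h => h0 (hV h)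
  obtain ⟨c, hc, hcV⟩ := Metric.mem_nhds_iff.1 h1
  refine ⟨c, hc, fun v hv => not_lt.1 fun hlt => hcV (mem_ball_zero_iff.2 hlt) (subset_closure hv)⟩

/-- Wavelet coefficients decay rapidly near regular directed points. -/
theorem exists_rapidDecayOn_of_isRegularDirectedPoint {V : ℕ → Set (Rd d)} (hVanti : Antitone V)
    (hVc : ∀ n, ∃ c : ℝ, 0 < c ∧ ∀ v ∈ V n, c ≤ ‖v‖) {ξ : Sph d} (hcone : WeakConeApprox H V ξ)
    {n₀ : ℕ} {W₀ : Set (Sph d)} (hW₀ : IsOpen W₀) (hξW₀ : ξ ∈ W₀) {R₀ : ℝ}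
    (hT : Tame (Ko H W₀ (V n₀) R₀)) (ψ : ℕ → 𝓢(Rd d, ℂ))
    (hψV : ∀ n, tsupport (𝓕 (ψ n) : 𝓢(Rd d, ℂ)) ⊆ V n) (u : 𝓢'(Rd d, ℂ)) (x : Rd d)
    (hreg : IsRegularDirectedPoint u x ξ) :
    ∃ W : Set (Sph d), IsOpen W ∧ ξ ∈ W ∧ ∃ R : ℝ, 0 < R ∧ ∃ U ∈ 𝓝 x, ∃ n₁ : ℕ,
      ∀ n ≥ n₁, RapidDecayOn (ψ n) u U (Ko H W (V n) R) := by
  obtain ⟨φ, hφ, hφc, hφ1, g, hg, hgu, W, hW, hξW, hdec⟩ := hreg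
  -- The radius 1 is arbitrary; only the inclusion in the cone over `W` is used.
  obtain ⟨n₂, R', hR', W', hW', hξW', hsub⟩ := hcone W hW hξW 1 one_pos
  obtain ⟨ρ, hρ, hρφ⟩ := Metric.eventually_nhds_iff_ball.1 hφ1
  have hε : 0 < ρ / 2 := by positivity
  -- Tameness is available from index `n₀` on and the cone inclusion from `n₂` on; both persist
  -- because the sets `V n` decrease.
  refine ⟨W' ∩ W₀, hW'.inter hW₀, ⟨hξW', hξW₀⟩, max R' R₀, lt_max_of_lt_left hR',
    Metric.ball x (ρ / 2), Metric.ball_mem_nhds x hε, max n₀ n₂, fun n hn N => ?_⟩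
  set K := Ko H (W' ∩ W₀) (V n) (max R' R₀) with hKdef
  have hKT : Tame K := hT.mono
    (Ko_mono inter_subset_right (hVanti ((le_max_left _ _).trans hn)) (le_max_right _ _))
  have hVn : V n ⊆ V n₂ := hVanti ((le_max_right _ _).trans hn)
  have hKW : ∀ h ∈ K, ∀ v ∈ V n, dualAct (h : GL (Fin d) ℝ)⁻¹ v ∈ cone W := by
    intro h hh v hv
    have h1 := hsub (Ko_mono inter_subset_left hVn (le_max_left _ _) hh)
    exact (mem_coneAbove.1 (h1 ⟨v, hVn hv, rfl⟩)).1
  obtain ⟨c, hc, hcV⟩ := hVc n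
  have hf : ∀ σ, σ ∉ V n → (𝓕 (conjSchwartz (ψ n))) (-σ) = 0 := fun σ hσ => by
    rw [fourier_conjSchwartz, image_eq_zero_of_notMem_tsupport fun h => hσ (hψV n h), map_zero]
  obtain ⟨C₁, h₁⟩ := exists_norm_integral_fourierInv_quasiRegular_le hKT hc hcV hKW hdec
    (conjSchwartz (ψ n)) hf N
  obtain ⟨C₂, h₂⟩ := exists_norm_away_le hKT (distCLM u) hφ hφc hε
    (fun y hy => hρφ y (by rwa [mul_div_cancel₀ ρ two_ne_zero] at hy)) (conjSchwartz (ψ n)) N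
  refine ⟨|C₁| + |C₂| + 1, by positivity, fun y hy h hh => ?_⟩
  set F := quasiRegular y (h : GL (Fin d) ℝ) (conjSchwartz (ψ n)) with hF
  -- Writing `F` as `𝓕 (𝓕⁻ F)` shifts the Fourier transform onto `φ u`, where it is integration
  -- against `g`.
  have e1 : u (SchwartzMap.smulLeftCLM ℂ φ F) = ∫ η, (𝓕⁻ F) η • g η := by
    rw [← Function.HasTemperateGrowth.toTemperedDistribution_apply volume hg, ← hgu,
      TemperedDistribution.fourier_apply, TemperedDistribution.smulLeftCLM_apply_apply,
      FourierTransform.fourier_fourierInv_eq]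
  have e2 : waveletTransform (ψ n) u y h = (∫ η, (𝓕⁻ F) η • g η) +
      distCLM u (F - SchwartzMap.smulLeftCLM ℂ φ F) := by
    rw [waveletTransform_eq, ← e1, map_sub, distCLM_apply, distCLM_apply]; ring
  rw [e2]
  have ht := pow_nonneg (opNorm_nonneg (h : GL (Fin d) ℝ)) N
  calc _ ≤ C₁ * opNorm (h : GL (Fin d) ℝ) ^ N + C₂ * opNorm (h : GL (Fin d) ℝ) ^ N :=
        (norm_add_le _ _).trans (add_le_add (h₁ y h hh) (h₂ y hy h hh))
    _ = (C₁ + C₂) * opNorm (h : GL (Fin d) ℝ) ^ N := by ring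
    _ ≤ _ := mul_le_mul_of_nonneg_right (by linarith [le_abs_self C₁, le_abs_self C₂]) ht

end Direct

/-! ### Local division and the kernel of the local inversion -/

section Inverse

variable {d : ℕ} {H : Subgroup (GL (Fin d) ℝ)}

/-- Local division by a Schwartz function that does not vanish at `-p`. -/
theorem exists_fourier_mul_eq_bump (Ψ : 𝓢(Rd d, ℂ)) {p : Rd d} (hp : Ψ (-p) ≠ 0) :
    ∃ (Θ : 𝓢(Rd d, ℂ)) (b : Rd d → ℂ) (ε : ℝ), 0 < ε ∧ ContDiff ℝ ∞ b ∧ HasCompactSupport b ∧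
      (∀ z, ‖z‖ < ε → b z = 1) ∧ ∀ ζ, (𝓕 Θ) ζ * Ψ ζ = b (ζ + p) := by
  have hnear : {z | Ψ z ≠ 0} ∈ 𝓝 (-p) :=
    (isOpen_ne_fun Ψ.continuous continuous_const).mem_nhds hp
  obtain ⟨ρ, hρ, hρΨ⟩ := Metric.mem_nhds_iff.1 hnear
  set β : ContDiffBump (0 : Rd d) := ⟨ρ / 3, ρ / 2, by positivity, by linarith⟩ with hβ
  set b : Rd d → ℂ := fun z => (β z : ℂ) with hb
  have hbs : ContDiff ℝ ∞ b := Complex.ofRealCLM.contDiff.comp β.contDiff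
  have hbc : HasCompactSupport b :=
    β.hasCompactSupport.comp_left (g := fun r : ℝ => (r : ℂ)) Complex.ofReal_zero
  have hb0 : ∀ z, ρ / 2 ≤ ‖z‖ → b z = 0 := fun z hz => by
    have : β z = 0 := β.zero_of_le_dist (by rwa [dist_zero_right])
    simp [hb, this]
  have hΨ0 : ∀ z, ‖z + p‖ < ρ → Ψ z ≠ 0 := fun z hz =>
    hρΨ (by rw [Metric.mem_ball, dist_eq_norm, sub_neg_eq_add]; exact hz)
  -- The quotient is smooth because the bump vanishes before the denominator can.
  set θ : Rd d → ℂ := fun ζ => b (ζ + p) * (Ψ ζ)⁻¹ with hθ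
  have hbp : ContDiff ℝ ∞ fun ζ => b (ζ + p) := hbs.comp (contDiff_id.add contDiff_const)
  have hθs : ContDiff ℝ ∞ θ := by
    refine contDiff_iff_contDiffAt.2 fun ζ => ?_
    rcases lt_or_ge ‖ζ + p‖ ρ with h | h
    · exact hbp.contDiffAt.mul ((Ψ.smooth ⊤).contDiffAt.inv (hΨ0 ζ h))
    · have hopen : IsOpen {z : Rd d | ρ / 2 < ‖z + p‖} :=
        isOpen_lt continuous_const (by fun_prop)
      have : θ =ᶠ[𝓝 ζ] fun _ => 0 := by
        filter_upwards [hopen.mem_nhds (show ρ / 2 < ‖ζ + p‖ by linarith)] with z hz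
        simp only [hθ, hb0 _ (le_of_lt hz), zero_mul]
      exact contDiffAt_const.congr_of_eventuallyEq this
  have hθc : HasCompactSupport θ :=
    (hbc.comp_homeomorph (Homeomorph.addRight p)).mul_right
  refine ⟨𝓕⁻ (hθc.toSchwartzMap hθs), b, ρ / 3, by positivity, hbs, hbc, fun z hz => ?_,
    fun ζ => ?_⟩
  · have : β z = 1 := β.one_of_mem_closedBall (by
      rw [mem_closedBall_zero_iff]; exact hz.le)
    simp [hb, this]
  · rw [FourierTransform.fourier_fourierInv_eq]
    change θ ζ * Ψ ζ = _
    rcases lt_or_ge ‖ζ + p‖ ρ with h | h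
    · simp only [hθ]
      rw [mul_assoc, inv_mul_cancel₀ (hΨ0 ζ h), mul_one]
    · simp only [hθ]
      rw [hb0 _ (by linarith), zero_mul, zero_mul]

theorem fourier_modS (f : 𝓢(Rd d, ℂ)) (η ζ : Rd d) : (𝓕 (modS η f)) ζ = (𝓕 f) (ζ + η) := by
  rw [fourier_eq_integral_chr, fourier_eq_integral_chr]
  simp only [modS_apply, chr_add_left, mul_assoc]

/-- Wavelets grow at most polynomially in all parameters. -/
theorem exists_norm_quasiRegular_le {K : Set H} (hK : Tame K) (u : 𝓢(Rd d, ℂ) →L[ℂ] ℂ)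
    (f : 𝓢(Rd d, ℂ)) (x : Rd d) :
    ∃ (C : ℝ) (M : ℕ), 0 ≤ C ∧ ∀ y, ∀ h ∈ K, ‖u (quasiRegular y (h : GL (Fin d) ℝ) f)‖ ≤
      C * ((1 + ‖y - x‖) * (1 + opNorm (h : GL (Fin d) ℝ)⁻¹)) ^ M := by
  obtain ⟨C, m, hC1, hK⟩ := hK
  obtain ⟨D, M, hD, h⟩ := norm_le_pow_of_seminorm_le u (univ ×ˢ K : Set (Rd d × H))
    (fun i => quasiRegular i.1 (i.2 : GL (Fin d) ℝ) f)
    (fun i => (1 + ‖i.1 - x‖) * (1 + opNorm (i.2 : GL (Fin d) ℝ)⁻¹))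
    (fun i _ => one_le_mul_of_one_le_of_one_le (by linarith [norm_nonneg (i.1 - x)])
      (by linarith [opNorm_nonneg (i.2 : GL (Fin d) ℝ)⁻¹])) (fun k l => by
      set q := (Finset.Iic (k, l)).sup (schwartzSeminormFamily ℂ (Rd d) ℂ) f with hq
      have hq0 : 0 ≤ q := apply_nonneg _ _
      refine ⟨(C + ‖x‖) ^ k * 2 ^ k * (1 + d.factorial) * q, k + l + d, fun i hi => ?_⟩
      obtain ⟨hKC, -⟩ := hK _ hi.2
      set h : GL (Fin d) ℝ := (i.2 : GL (Fin d) ℝ) with hh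
      have hn := opNorm_nonneg h⁻¹
      have ht0 := opNorm_nonneg h
      have hδ := detFactor_le h
      have hδ0 := detFactor_pos h
      have hx0 := norm_nonneg x
      have hy0 := norm_nonneg (i.1 - x)
      have hpull := seminorm_comp_affine_le k l (linEquiv h⁻¹) i.1
        ((detFactor h : ℂ) • f) (quasiRegular i.1 h f) (fun z => by
          rw [quasiRegular_eq, smul_apply, smul_eq_mul])
      rw [linEquiv_inv_symm, norm_linEquiv, norm_linEquiv, map_smul_eq_mul, Complex.norm_real,
        Real.norm_of_nonneg hδ0.le, ← hq] at hpull
      have h1 : opNorm h + ‖i.1‖ ≤ (C + ‖x‖) * (1 + ‖i.1 - x‖) := by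
        have : ‖i.1‖ ≤ ‖x‖ + ‖i.1 - x‖ := by
          have e : i.1 = x + (i.1 - x) := by abel
          conv_lhs => rw [e]
          exact norm_add_le _ _
        nlinarith [mul_nonneg hx0 hy0]
      have h2 : 1 ≤ 1 + ‖i.1 - x‖ := by linarith
      have h3 : 1 ≤ 1 + opNorm h⁻¹ := by linarith
      calc _ ≤ _ := hpull
        _ ≤ (1 + opNorm h⁻¹) ^ l * ((C + ‖x‖) * (1 + ‖i.1 - x‖)) ^ k *
            (2 ^ k * ((1 + d.factorial) * (1 + opNorm h⁻¹) ^ d * q)) := by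
          gcongr
          linarith
        _ = (C + ‖x‖) ^ k * 2 ^ k * (1 + d.factorial) * q *
            ((1 + ‖i.1 - x‖) ^ k * (1 + opNorm h⁻¹) ^ (l + d)) := by
          rw [mul_pow, pow_add _ l d]; ring
        _ ≤ (C + ‖x‖) ^ k * 2 ^ k * (1 + d.factorial) * q *
            ((1 + ‖i.1 - x‖) ^ (k + l + d) * (1 + opNorm h⁻¹) ^ (k + l + d)) := by
          gcongr (C + ‖x‖) ^ k * 2 ^ k * (1 + d.factorial) * q * (?_ * ?_)
          · exact pow_le_pow_right₀ h2 (by omega)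
          · exact pow_le_pow_right₀ h3 (by omega)
        _ = _ := by rw [mul_pow])
  exact ⟨D, M, hD, fun y g hg => h (y, g) ⟨mem_univ _, hg⟩⟩

/-- The test function that pairs with the wavelet transform in the local inversion formula. -/
noncomputable def localKernel (h : GL (Fin d) ℝ) (f Θ : 𝓢(Rd d, ℂ)) (η : Rd d) : 𝓢(Rd d, ℂ) :=
  ((detFactor h * detFactor h : ℝ) : ℂ) •
    SchwartzMap.convolution (ContinuousLinearMap.mul ℂ ℂ) (modS η f) (quasiRegular 0 h Θ)

/-- The normalization is chosen so that multiplying by the Fourier transform of `quasiRegular 0 h χ`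
cancels all determinants. -/
theorem fourier_localKernel (h : GL (Fin d) ℝ) (f Θ : 𝓢(Rd d, ℂ)) (η ζ : Rd d) :
    (𝓕 (localKernel h f Θ η)) ζ =
      ((detFactor h : ℝ) : ℂ) * ((𝓕 f) (ζ + η) * (𝓕 Θ) (dualAct h ζ)) := by
  have hδ : (detFactor h : ℂ) ≠ 0 := by exact_mod_cast (detFactor_pos h).ne'
  rw [localKernel, FourierTransform.fourier_smul, smul_apply, SchwartzMap.fourier_convolution,
    SchwartzMap.pairing_apply_apply, fourier_modS, fourier_quasiRegular]
  simp only [chr, inner_zero_left, ContinuousLinearMap.mul_apply', smul_eq_mul]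
  push_cast
  rw [mul_zero, Complex.exp_zero]
  field_simp

/-- The factor `‖f z‖` on both sides of `hB` restricts the bound on `Θ` to points where `f` does not
vanish. -/
theorem norm_localKernel_le (h : GL (Fin d) ℝ) (f Θ : 𝓢(Rd d, ℂ)) (η y : Rd d) {B : ℝ}
    (hB : ∀ z, ‖f z‖ * ‖Θ (linEquiv h⁻¹ (y - z))‖ ≤ ‖f z‖ * B) :
    ‖localKernel h f Θ η y‖ ≤ detFactor h ^ 3 * (B * ∫ z, ‖f z‖) := by
  have hδ := (detFactor_pos h).le
  rw [localKernel, smul_apply, norm_smul, Complex.norm_real,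
    Real.norm_of_nonneg (mul_nonneg hδ hδ), SchwartzMap.convolution_apply, MeasureTheory.convolution]
  have h1 : ‖∫ z, (ContinuousLinearMap.mul ℂ ℂ) (modS η f z) (quasiRegular 0 h Θ (y - z))‖ ≤
      ∫ z, detFactor h * B * ‖f z‖ := by
    refine norm_integral_le_of_norm_le ((f.integrable.norm).const_mul _)
      (Filter.Eventually.of_forall fun z => ?_)
    rw [ContinuousLinearMap.mul_apply', modS_apply, quasiRegular_eq, norm_mul, norm_mul, norm_mul,
      norm_chr, one_mul, Complex.norm_real, Real.norm_of_nonneg hδ, sub_zero]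
    have := mul_le_mul_of_nonneg_left (hB z) hδ
    linarith
  refine (mul_le_mul_of_nonneg_left h1 (mul_nonneg hδ hδ)).trans (le_of_eq ?_)
  rw [integral_const_mul]; ring

theorem detFactor_pow_three_le (h : GL (Fin d) ℝ) :
    detFactor h ^ 3 ≤ (1 + d.factorial) ^ 3 * (1 + opNorm h⁻¹) ^ (3 * d) := by
  calc _ ≤ ((1 + d.factorial) * (1 + opNorm h⁻¹) ^ d) ^ 3 :=
        pow_le_pow_left₀ (detFactor_pos h).le (detFactor_le h) 3
    _ = _ := by rw [mul_pow, ← pow_mul, mul_comm d 3]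

theorem exists_norm_localKernel_le (f Θ : 𝓢(Rd d, ℂ)) :
    ∃ C : ℝ, 0 ≤ C ∧ ∀ (h : GL (Fin d) ℝ) (η y : Rd d), ‖localKernel h f Θ η y‖ ≤
      C * (1 + opNorm h⁻¹) ^ (3 * d) := by
  set S := SchwartzMap.seminorm ℂ 0 0 Θ with hS
  have hS0 : 0 ≤ S := apply_nonneg _ _
  have hI : 0 ≤ ∫ z, ‖f z‖ := integral_nonneg fun _ => norm_nonneg _
  refine ⟨(1 + d.factorial) ^ 3 * (S * ∫ z, ‖f z‖), by positivity, fun h η y => ?_⟩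
  refine (norm_localKernel_le h f Θ η y (B := S) fun z => ?_).trans ?_
  · gcongr
    exact SchwartzMap.norm_le_seminorm ℂ Θ _
  · rw [mul_right_comm]
    exact mul_le_mul_of_nonneg_right (detFactor_pow_three_le h) (by positivity)

/-- For `z` in the support of `f` and `y` far from `x`, the argument `h⁻¹(y - z)` has norm at least
`‖y - z‖ / ‖h‖`, so the Schwartz decay of `Θ` gives both powers. -/
theorem exists_norm_localKernel_away_le {f : 𝓢(Rd d, ℂ)} (Θ : 𝓢(Rd d, ℂ)) {x : Rd d} {ε : ℝ}
    (hε : 0 < ε) (hf : ∀ z, z ∉ Metric.ball x ε → f z = 0) (N : ℕ) :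
    ∃ C : ℝ, 0 ≤ C ∧ ∀ (h : GL (Fin d) ℝ) (η y : Rd d), y ∉ Metric.ball x (2 * ε) →
      ‖localKernel h f Θ η y‖ ≤
        C * (1 + opNorm h⁻¹) ^ (3 * d) * opNorm h ^ N * ((1 + ‖y - x‖) ^ N)⁻¹ := by
  set S := SchwartzMap.seminorm ℂ N 0 Θ with hS
  have hS0 : 0 ≤ S := apply_nonneg _ _
  have hI : 0 ≤ ∫ z, ‖f z‖ := integral_nonneg fun _ => norm_nonneg _
  refine ⟨(1 + d.factorial) ^ 3 * ((2 + ε⁻¹) ^ N * S * ∫ z, ‖f z‖), by positivity,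
    fun h η y hy => ?_⟩
  have ht0 := opNorm_nonneg h
  have hn0 := opNorm_nonneg h⁻¹
  refine (norm_localKernel_le h f Θ η y
    (B := (2 + ε⁻¹) ^ N * opNorm h ^ N * S * ((1 + ‖y - x‖) ^ N)⁻¹) fun z => ?_).trans ?_
  · by_cases hz : z ∈ Metric.ball x ε
    · refine mul_le_mul_of_nonneg_left ?_ (norm_nonneg _)
      set w := linEquiv h⁻¹ (y - z) with hw
      have h1 : ‖y - z‖ ≤ opNorm h * ‖w‖ := by
        have := norm_linEquiv_le h w
        rwa [hw, linEquiv_linEquiv_inv] at this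
      rw [Metric.mem_ball, dist_eq_norm] at hz hy
      have h2 : ‖y - x‖ ≤ ‖y - z‖ + ‖z - x‖ := norm_sub_le_norm_sub_add_norm_sub _ _ _
      -- Here `‖z - x‖ < ε ≤ ‖y - z‖`: the summand 2 bounds `‖y - x‖` and `ε⁻¹` bounds the constant
      -- 1.
      have h3 : 1 + ‖y - x‖ ≤ (2 + ε⁻¹) * ‖y - z‖ := by
        have h4 : ε ≤ ‖y - z‖ := by linarith
        have h5 : 1 ≤ ε⁻¹ * ‖y - z‖ := by
          rw [← div_eq_inv_mul, one_le_div hε]; exact h4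
        linarith
      rw [← div_eq_mul_inv, le_div_iff₀ (by positivity)]
      have h6 : ‖w‖ ^ N * ‖Θ w‖ ≤ S := SchwartzMap.norm_pow_mul_le_seminorm ℂ Θ N w
      calc ‖Θ w‖ * (1 + ‖y - x‖) ^ N ≤ ‖Θ w‖ * ((2 + ε⁻¹) * (opNorm h * ‖w‖)) ^ N := by
            gcongr
            exact h3.trans (by gcongr)
        _ = (2 + ε⁻¹) ^ N * opNorm h ^ N * (‖w‖ ^ N * ‖Θ w‖) := by rw [mul_pow, mul_pow]; ring
        _ ≤ _ := by gcongr
    · rw [hf z hz, norm_zero, zero_mul, zero_mul]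
  · calc _ ≤ ((1 + d.factorial) ^ 3 * (1 + opNorm h⁻¹) ^ (3 * d)) *
          ((2 + ε⁻¹) ^ N * opNorm h ^ N * S * ((1 + ‖y - x‖) ^ N)⁻¹ * ∫ z, ‖f z‖) :=
          mul_le_mul_of_nonneg_right (detFactor_pow_three_le h) (by positivity)
      _ = _ := by ring

/-- Near `x` the coefficients decay and the kernel grows only polynomially in `‖h⁻¹‖`; far from `x`
the roles are exchanged. -/
theorem exists_norm_integral_localKernel_le {K : Set H} (hK : Tame K) (u : 𝓢(Rd d, ℂ) →L[ℂ] ℂ)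
    (χ Θ : 𝓢(Rd d, ℂ)) {f : 𝓢(Rd d, ℂ)} {x : Rd d} {ε : ℝ} (hε : 0 < ε)
    (hf : ∀ z, z ∉ Metric.ball x ε → f z = 0)
    (hdec : ∀ N : ℕ, ∃ C : ℝ, 0 ≤ C ∧ ∀ y ∈ Metric.ball x (2 * ε), ∀ h ∈ K,
      ‖u (quasiRegular y (h : GL (Fin d) ℝ) χ)‖ ≤ C * opNorm (h : GL (Fin d) ℝ) ^ N) (N : ℕ) :
    ∃ C : ℝ, 0 ≤ C ∧ ∀ h ∈ K, ∀ η, ‖∫ y, localKernel (h : GL (Fin d) ℝ) f Θ η y *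
      u (quasiRegular y (h : GL (Fin d) ℝ) χ)‖ ≤ C * opNorm (h : GL (Fin d) ℝ) ^ N := by
  obtain ⟨D, M, hD0, hD⟩ := exists_norm_quasiRegular_le hK u χ x
  obtain ⟨C, m, hC1, hK⟩ := hK
  have hC0 : 0 ≤ C := zero_le_one.trans hC1
  set N₁ := N + m * (3 * d) with hN₁
  set N₂ := N + m * (3 * d + M) with hN₂
  obtain ⟨A₁, hA₁, hA₁'⟩ := exists_norm_localKernel_le f Θ
  obtain ⟨E, hE, hE'⟩ := hdec N₁
  -- Of the extra decay in `y`, `M` powers offset the growth of the coefficients and `d + 1` give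
  -- integrability; `N₂` pays for the `3 * d + M` powers of `1 + ‖h⁻¹‖`.
  obtain ⟨A₂, hA₂, hA₂'⟩ := exists_norm_localKernel_away_le Θ hε hf (N₂ + (M + (d + 1)))
  set J₁ := A₁ * E * C ^ (3 * d) * (1 + 2 * ε) ^ (d + 1) with hJ₁
  set J₂ := A₂ * D * C ^ (M + (d + 1)) * C ^ (3 * d + M) with hJ₂
  have hJ₁0 : 0 ≤ J₁ := by positivity
  have hJ₂0 : 0 ≤ J₂ := by positivity
  have hint : Integrable fun y : Rd d => ((1 + ‖y - x‖) ^ (d + 1))⁻¹ :=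
    integrable_inv_one_add_norm_pow.comp_sub_right x
  refine ⟨(J₁ + J₂) * ∫ y : Rd d, ((1 + ‖y - x‖) ^ (d + 1))⁻¹,
    mul_nonneg (by positivity) (integral_nonneg fun y => by positivity), fun h hh η => ?_⟩
  obtain ⟨hKC, hKm⟩ := hK h hh
  set g : GL (Fin d) ℝ := (h : GL (Fin d) ℝ) with hg
  have ht0 := opNorm_nonneg g
  have hn0 := opNorm_nonneg g⁻¹
  have key : ∀ y, ‖localKernel g f Θ η y * u (quasiRegular y g χ)‖ ≤
      ((J₁ + J₂) * opNorm g ^ N) * ((1 + ‖y - x‖) ^ (d + 1))⁻¹ := by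
    intro y
    rw [norm_mul]
    have hr0 := norm_nonneg (y - x)
    by_cases hy : y ∈ Metric.ball x (2 * ε)
    · have hy' : ‖y - x‖ < 2 * ε := by rwa [Metric.mem_ball, dist_eq_norm] at hy
      calc _ ≤ A₁ * (1 + opNorm g⁻¹) ^ (3 * d) * (E * opNorm g ^ N₁) :=
            mul_le_mul (hA₁' g η y) (hE' y hy h hh) (norm_nonneg _) (by positivity)
        _ = A₁ * E * (opNorm g ^ N₁ * (1 + opNorm g⁻¹) ^ (3 * d)) := by ring
        _ ≤ A₁ * E * (C ^ (3 * d) * opNorm g ^ N) :=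
            mul_le_mul_of_nonneg_left (pow_mul_pow_le hKm N (3 * d)) (by positivity)
        _ ≤ A₁ * E * (C ^ (3 * d) * opNorm g ^ N) *
            ((1 + 2 * ε) ^ (d + 1) * ((1 + ‖y - x‖) ^ (d + 1))⁻¹) := by
            refine le_mul_of_one_le_right (by positivity) ?_
            rw [← div_eq_mul_inv, one_le_div (by positivity)]
            gcongr
        _ = J₁ * opNorm g ^ N * ((1 + ‖y - x‖) ^ (d + 1))⁻¹ := by rw [hJ₁]; ring
        _ ≤ _ := by
            gcongr
            linarith
    · have hr1 : 0 < 1 + ‖y - x‖ := by linarith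
      calc _ ≤ A₂ * (1 + opNorm g⁻¹) ^ (3 * d) * opNorm g ^ (N₂ + (M + (d + 1))) *
            ((1 + ‖y - x‖) ^ (N₂ + (M + (d + 1))))⁻¹ *
            (D * ((1 + ‖y - x‖) * (1 + opNorm g⁻¹)) ^ M) :=
            mul_le_mul (hA₂' g η y hy) (hD y h hh) (norm_nonneg _) (by positivity)
        _ = A₂ * D * opNorm g ^ (M + (d + 1)) *
            (opNorm g ^ N₂ * (1 + opNorm g⁻¹) ^ (3 * d + M)) *
            (((1 + ‖y - x‖) ^ N₂)⁻¹ * ((1 + ‖y - x‖) ^ (d + 1))⁻¹) := by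
            rw [pow_add (opNorm g), pow_add (1 + ‖y - x‖) N₂, pow_add (1 + ‖y - x‖) M,
              pow_add (1 + opNorm g⁻¹), mul_pow]
            field_simp
        _ ≤ A₂ * D * C ^ (M + (d + 1)) * (C ^ (3 * d + M) * opNorm g ^ N) *
            (1 * ((1 + ‖y - x‖) ^ (d + 1))⁻¹) := by
            refine mul_le_mul (mul_le_mul ?_ (pow_mul_pow_le hKm N (3 * d + M)) (by positivity)
              (by positivity)) ?_ (by positivity) (by positivity)
            · gcongr
            · gcongr
              exact inv_le_one_of_one_le₀ (one_le_pow₀ (by linarith))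
        _ = J₂ * opNorm g ^ N * ((1 + ‖y - x‖) ^ (d + 1))⁻¹ := by rw [hJ₂]; ring
        _ ≤ _ := by
            gcongr
            linarith
  refine (norm_integral_le_of_norm_le (hint.const_mul _)
    (Filter.Eventually.of_forall key)).trans (le_of_eq ?_)
  rw [integral_const_mul]; ring

end Inverse

/-! ### Local inversion with one dilation per frequency -/

section LocalInversion

variable {d : ℕ} {H : Subgroup (GL (Fin d) ℝ)}

/-- The part of a localized Fourier transform away from the frequency `η` is rapidly small. -/
theorem exists_norm_frequency_away_le {K : Set H} (hK : Tame K) (v : 𝓢(Rd d, ℂ) →L[ℂ] ℂ)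
    {b : Rd d → ℂ} (hb : ContDiff ℝ ∞ b) (hbc : HasCompactSupport b) {ε : ℝ} (hε : 0 < ε)
    (hb1 : ∀ z, ‖z‖ < ε → b z = 1) (f : 𝓢(Rd d, ℂ)) (p : Rd d) (F : H × Rd d → 𝓢(Rd d, ℂ))
    (hF : ∀ i ζ, dualAct (i.1 : GL (Fin d) ℝ) i.2 = p →
      F i ζ = (1 - b (dualAct (i.1 : GL (Fin d) ℝ) ζ + p)) * f (ζ + i.2)) (N : ℕ) :
    ∃ C : ℝ, 0 ≤ C ∧ ∀ h ∈ K, ∀ η, dualAct (h : GL (Fin d) ℝ) η = p →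
      ‖v (F (h, η))‖ ≤ C * opNorm (h : GL (Fin d) ℝ) ^ N := by
  obtain ⟨C, m, hC1, hK⟩ := hK
  have hC0 : 0 ≤ C := zero_le_one.trans hC1
  set s : Set (H × Rd d) := {i | i.1 ∈ K ∧ dualAct (i.1 : GL (Fin d) ℝ) i.2 = p} with hs
  set w : ℕ → H × Rd d → ℝ := fun N i => opNorm (i.1 : GL (Fin d) ℝ) ^ N with hw
  have hw0 : ∀ N i, 0 ≤ w N i := fun N i => pow_nonneg (opNorm_nonneg _) _
  -- Since `h` sends `η` to `p`, shifting the frequency by `η` removes `p` from the cutoff and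
  -- leaves `(1 - b(hᵀ τ)) f(τ)`, to which the cutoff estimate applies uniformly.
  set F₁ : H × Rd d → 𝓢(Rd d, ℂ) := fun i => SchwartzMap.compSubConstCLM ℂ i.2 (F i) with hF₁
  have hF₁a : ∀ i ∈ s, ∀ τ, F₁ i τ = (1 - b (dualCLM (i.1 : GL (Fin d) ℝ) τ)) * f τ :=
    fun i hi τ => by
      simp only [hF₁, SchwartzMap.compSubConstCLM_apply]
      rw [hF i _ hi.2, sub_add_cancel, ← hi.2, ← dualAct_add, sub_add_cancel, dualCLM_apply]
  have h1 : ∀ (N k l : ℕ), ∃ D : ℝ, ∀ i ∈ s, SchwartzMap.seminorm ℂ k l (F₁ i) ≤ D * w N i := by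
    intro N k l
    obtain ⟨B, hB, hBb⟩ := exists_bound_iteratedFDeriv_one_sub hb hbc l
    obtain ⟨D, hD⟩ := exists_seminorm_cutoff_le N k l f hε hB hC0
    refine ⟨D, fun i hi => ?_⟩
    have := hD (fun z => 1 - b z) (dualCLM (i.1 : GL (Fin d) ℝ)) (F₁ i) (contDiff_const.sub hb) hBb
      (fun z hz => by rw [hb1 z hz, sub_self]) (by rw [norm_dualCLM]; exact (hK _ hi.1).1) (hF₁a i hi)
    rwa [norm_dualCLM] at this
  obtain ⟨D, hD0, hD⟩ := norm_le_of_seminorm_le v s F (w N) (fun i _ => hw0 N i) (fun k l => by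
    -- Shifting back costs `(1 + ‖η‖) ^ k`, hence `k` powers of `1 + ‖h⁻¹‖`.
    obtain ⟨D, hD0, hD⟩ := sup_seminorm_le s F₁ (w (N + m * k)) (fun i _ => hw0 _ i)
      (h1 (N + m * k)) (Finset.Iic (k, l))
    refine ⟨(1 + ‖p‖) ^ k * 2 ^ k * D * C ^ k, fun i hi => ?_⟩
    obtain ⟨-, hKm⟩ := hK _ hi.1
    set h : GL (Fin d) ℝ := (i.1 : GL (Fin d) ℝ) with hh
    have hn := opNorm_nonneg h⁻¹
    have ht := opNorm_nonneg h
    have hp := norm_nonneg p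
    have hη : ‖i.2‖ ≤ opNorm h⁻¹ * ‖p‖ := by
      have := norm_dualAct_le h⁻¹ p
      have hip : dualAct h i.2 = p := hi.2
      rwa [← hip, dualAct_inv_dualAct, hip] at this
    have hη' : 1 + ‖-i.2‖ ≤ (1 + ‖p‖) * (1 + opNorm h⁻¹) := by
      rw [norm_neg]
      nlinarith
    have hpull := seminorm_comp_affine_le k l (ContinuousLinearEquiv.refl ℝ (Rd d)) (-i.2)
      (F₁ i) (F i) (fun z => by
        simp only [hF₁, SchwartzMap.compSubConstCLM_apply, ContinuousLinearEquiv.coe_refl',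
          id_eq, sub_neg_eq_add, add_sub_cancel_right])
    have hid : ‖((ContinuousLinearEquiv.refl ℝ (Rd d) : Rd d ≃L[ℝ] Rd d) : Rd d →L[ℝ] Rd d)‖ ≤ 1 :=
      ContinuousLinearMap.norm_id_le
    calc SchwartzMap.seminorm ℂ k l (F i) ≤ _ := hpull
      _ ≤ 1 ^ l * ((1 + ‖p‖) * (1 + opNorm h⁻¹)) ^ k * (2 ^ k * (D * w (N + m * k) i)) := by
          refine mul_le_mul (mul_le_mul (pow_le_pow_left₀ (norm_nonneg _) hid _)
            (pow_le_pow_left₀ (by positivity) ((add_le_add_left hid _).trans hη') _)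
            (by positivity) (by positivity)) ?_ (by positivity) (by positivity)
          exact mul_le_mul_of_nonneg_left (hD i hi) (by positivity)
      _ = (1 + ‖p‖) ^ k * 2 ^ k * D * (opNorm h ^ (N + m * k) * (1 + opNorm h⁻¹) ^ k) := by
          rw [mul_pow, one_pow]; simp only [hw]; ring
      _ ≤ (1 + ‖p‖) ^ k * 2 ^ k * D * (C ^ k * opNorm h ^ N) :=
          mul_le_mul_of_nonneg_left (pow_mul_pow_le hKm N k) (by positivity)
      _ = _ := by simp only [hw]; ring)
  exact ⟨D, hD0, fun h hh η hη => hD (h, η) ⟨hh, hη⟩⟩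

/-- Wavelet coefficients that decay rapidly control the localized Fourier transform. -/
theorem exists_norm_clm_modS_le {K : Set H} (hK : Tame K) (u : 𝓢(Rd d, ℂ) →L[ℂ] ℂ)
    {χ : 𝓢(Rd d, ℂ)} {p : Rd d} (hp : (𝓕 χ) (-p) ≠ 0) {f : 𝓢(Rd d, ℂ)} {x : Rd d} {ε : ℝ}
    (hε : 0 < ε) (hf : ∀ z, z ∉ Metric.ball x ε → f z = 0)
    (hdec : ∀ N : ℕ, ∃ C : ℝ, 0 ≤ C ∧ ∀ y ∈ Metric.ball x (2 * ε), ∀ h ∈ K,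
      ‖u (quasiRegular y (h : GL (Fin d) ℝ) χ)‖ ≤ C * opNorm (h : GL (Fin d) ℝ) ^ N) (N : ℕ) :
    ∃ C : ℝ, 0 ≤ C ∧ ∀ h ∈ K, ∀ η, dualAct (h : GL (Fin d) ℝ) η = p →
      ‖u (modS η f)‖ ≤ C * opNorm (h : GL (Fin d) ℝ) ^ N := by
  obtain ⟨Θ, b, r, hr, hb, hbc, hb1, hΘ⟩ := exists_fourier_mul_eq_bump (𝓕 χ) hp
  -- Passing to the frequency side turns the splitting of the test function into multiplication by a
  -- bump and its complement.
  set v : 𝓢(Rd d, ℂ) →L[ℂ] ℂ := u.comp (FourierTransform.fourierInvCLM ℂ 𝓢(Rd d, ℂ)) with hv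
  have hvu : ∀ g : 𝓢(Rd d, ℂ), v (𝓕 g) = u g := fun g => by
    change u (𝓕⁻ (𝓕 g)) = u g
    rw [FourierTransform.fourierInv_fourier_eq]
  set near : H × Rd d → 𝓢(Rd d, ℂ) := fun i =>
    SchwartzMap.pairing (ContinuousLinearMap.mul ℂ ℂ)
      (𝓕 (quasiRegular 0 (i.1 : GL (Fin d) ℝ) χ))
      (𝓕 (localKernel (i.1 : GL (Fin d) ℝ) f Θ i.2)) with hnear
  have hnearm : ∀ i ζ, near i ζ = (𝓕 (quasiRegular 0 (i.1 : GL (Fin d) ℝ) χ)) ζ *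
      (𝓕 (localKernel (i.1 : GL (Fin d) ℝ) f Θ i.2)) ζ := fun i ζ => by
    simp only [hnear, SchwartzMap.pairing_apply_apply, ContinuousLinearMap.mul_apply']
  have hneara : ∀ i ζ, near i ζ =
      b (dualAct (i.1 : GL (Fin d) ℝ) ζ + p) * (𝓕 f) (ζ + i.2) := fun i ζ => by
    have hδ : (detFactor (i.1 : GL (Fin d) ℝ) : ℂ) ≠ 0 := by
      exact_mod_cast (detFactor_pos _).ne'
    rw [hnearm, fourier_localKernel, fourier_quasiRegular, ← hΘ]
    simp only [chr, inner_zero_left]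
    push_cast
    rw [mul_zero, Complex.exp_zero]
    field_simp
  -- The near part is a product of two Fourier transforms; expanding that of the kernel yields an
  -- integral over wavelets with the same `h`.
  have hvnear : ∀ i, v (near i) = ∫ y, localKernel (i.1 : GL (Fin d) ℝ) f Θ i.2 y *
      u (quasiRegular y (i.1 : GL (Fin d) ℝ) χ) := fun i => by
    rw [clm_mul_fourier_eq_integral v _ _ _ (hnearm i)]
    simp only [← quasiRegular_fourier, hvu]
  obtain ⟨C₁, hC₁, h₁⟩ := exists_norm_integral_localKernel_le hK u χ Θ hε hf hdec N
  obtain ⟨C₂, hC₂, h₂⟩ := exists_norm_frequency_away_le hK v hb hbc hr hb1 (𝓕 f) p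
    (fun i => 𝓕 (modS i.2 f) - near i) (fun i ζ _ => by
      rw [sub_apply, hneara, fourier_modS]; ring) N
  refine ⟨C₁ + C₂, by positivity, fun h hh η hη => ?_⟩
  have e : u (modS η f) = v (near (h, η)) + v (𝓕 (modS η f) - near (h, η)) := by
    rw [map_sub, hvu]; ring
  rw [e, hvnear, add_mul]
  exact (norm_add_le _ _).trans (add_le_add (h₁ h hh η) (h₂ h hh η hη))

end LocalInversion

/-! ### Rapidly decaying coefficients give regular directed points -/

section Converse

variable {d : ℕ} {H : Subgroup (GL (Fin d) ℝ)} {ξ₀ : Rd d}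

theorem Admissible.exists_fourier_ne_zero [MeasurableSpace H] {μ : Measure H} {O : Set (Rd d)}
    {ψ : 𝓢(Rd d, ℂ)} (hψ : Admissible H μ O ψ) {ξ : Rd d} (hξ : ξ ∈ O) :
    ∃ h ∈ H, (𝓕 ψ) (dualAct h ξ) ≠ 0 := by
  by_contra! hcon
  have h1 := hψ ξ hξ
  have h2 : ∀ h : H, ‖(𝓕 ψ) (dualAct (h : GL (Fin d) ℝ) ξ)‖ ^ 2 = 0 := fun h => by
    rw [hcon _ h.2, norm_zero, zero_pow two_ne_zero]
  simp only [h2, integral_zero, zero_ne_one] at h1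

/-- A point near which the wavelet coefficients decay rapidly is a regular directed point. -/
theorem isRegularDirectedPoint_of_rapidDecayOn (hO : IsOpen (dualOrbit H ξ₀)) {ξ : Sph d}
    (hξ : (ξ : Rd d) ∈ dualOrbit H ξ₀) {V : Set (Rd d)} {W₀ : Set (Sph d)} (hW₀ : IsOpen W₀)
    (hξW₀ : ξ ∈ W₀) {R₀ : ℝ} (hT : Tame (Ko H W₀ V R₀)) {W : Set (Sph d)} (hW : IsOpen W)
    (hξW : ξ ∈ W) {R : ℝ} (hR : 0 < R) {x : Rd d} {U : Set (Rd d)} (hU : U ∈ 𝓝 x)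
    {ψ : 𝓢(Rd d, ℂ)} {p : Rd d} (hpO : p ∈ dualOrbit H ξ₀) (hpV : p ∈ V) (hp : (𝓕 ψ) p ≠ 0)
    {u : 𝓢'(Rd d, ℂ)} (hdec : RapidDecayOn ψ u U (Ko H W V R)) :
    IsRegularDirectedPoint u x ξ := by
  obtain ⟨r, hr, hrU⟩ := Metric.mem_nhds_iff.1 hU
  set β : ContDiffBump x := ⟨r / 4, r / 2, by positivity, by linarith⟩ with hβ
  set φ : Rd d → ℂ := fun z => (β z : ℂ) with hφ
  have hφs : ContDiff ℝ ∞ φ := Complex.ofRealCLM.contDiff.comp β.contDiff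
  have hφc : HasCompactSupport φ :=
    β.hasCompactSupport.comp_left (g := fun r : ℝ => (r : ℂ)) Complex.ofReal_zero
  have hφ1 : ∀ᶠ y in 𝓝 x, φ y = 1 := by
    filter_upwards [β.eventuallyEq_one] with y hy
    simp only [hφ, hy, Pi.one_apply, Complex.ofReal_one]
  set f : 𝓢(Rd d, ℂ) := hφc.toSchwartzMap hφs with hf
  have hfφ : ∀ z, f z = φ z := fun z => rfl
  have hf0 : ∀ z, z ∉ Metric.ball x (r / 2) → f z = 0 := fun z hz => by
    rw [hfφ, hφ]
    have : β z = 0 := β.zero_of_le_dist (not_lt.1 hz)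
    simp only [this, Complex.ofReal_zero]
  have hg := hasTemperateGrowth_clm_modS (distCLM u) f
  -- Intersecting with the orbit puts the whole cone over `W'` inside it, so every frequency there
  -- can be moved to `p`.
  set W' : Set (Sph d) := W ∩ W₀ ∩ {w | (w : Rd d) ∈ dualOrbit H ξ₀} with hW'
  set R₁ := max R R₀ with hR₁
  set K : Set H := Ko H W' V R₁ with hK
  have hKT : Tame K := hT.mono
    (Ko_mono (inter_subset_left.trans inter_subset_right) subset_rfl (le_max_right _ _))
  have hKdec : ∀ N : ℕ, ∃ C : ℝ, 0 ≤ C ∧ ∀ y ∈ Metric.ball x (2 * (r / 2)), ∀ h ∈ K,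
      ‖distCLM u (quasiRegular y (h : GL (Fin d) ℝ) (conjSchwartz ψ))‖ ≤
        C * opNorm (h : GL (Fin d) ℝ) ^ N := fun N => by
    obtain ⟨C, hC, h⟩ := hdec N
    refine ⟨C, hC.le, fun y hy g hg => ?_⟩
    rw [distCLM_apply, ← waveletTransform_eq]
    rw [mul_div_cancel₀ r two_ne_zero] at hy
    exact h y (hrU hy) g
      (Ko_mono (inter_subset_left.trans inter_subset_left) subset_rfl (le_max_left _ _) hg)
  have hχ : (𝓕 (conjSchwartz ψ)) (-p) ≠ 0 := by
    rw [fourier_conjSchwartz]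
    exact fun h => hp ((map_eq_zero _).1 h)
  refine ⟨φ, hφs, hφc, hφ1, fun η => distCLM u (modS η f), hg, ?_, W',
    (hW.inter hW₀).inter (hO.preimage continuous_subtype_val), ⟨⟨hξW, hξW₀⟩, hξ⟩, fun N => ?_⟩
  -- This identifies the Fourier transform of `φ u` with `η ↦ u (modS η f)`.
  · ext F
    rw [TemperedDistribution.fourier_apply, TemperedDistribution.smulLeftCLM_apply_apply,
      Function.HasTemperateGrowth.toTemperedDistribution_apply volume hg]
    simp only [smul_eq_mul]
    refine clm_mul_fourier_eq_integral (distCLM u) f F _ fun ζ => ?_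
    rw [SchwartzMap.smulLeftCLM_apply_apply (hφc.hasTemperateGrowth hφs), smul_eq_mul, hfφ]
  · obtain ⟨C, m, hC1, hKT'⟩ := id hKT
    -- By tameness, `m` powers of `‖h‖` are worth one power of `(1 + ‖η‖)⁻¹`; hence the exponent `m
    -- * N`.
    obtain ⟨D, hD, hDK⟩ := exists_norm_clm_modS_le hKT (distCLM u) hχ (by positivity : 0 < r / 2)
      hf0 hKdec (m * N)
    obtain ⟨M, hM⟩ := (isCompact_closedBall (0 : Rd d) R₁).exists_bound_of_continuousOn
      (continuous_clm_modS (distCLM u) f).continuousOn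
    have hR₁0 : 0 < R₁ := lt_max_of_lt_left hR
    have hp0 := norm_nonneg p
    have hM0 : 0 ≤ M := (norm_nonneg _).trans (hM 0 (Metric.mem_closedBall_self hR₁0.le))
    set E := (1 + ‖p‖) * C with hE
    have hE0 : 0 < E := by positivity
    refine ⟨D * E ^ N + M * (1 + R₁) ^ N + 1, by positivity, fun η hη => ?_⟩
    have hη0 := norm_nonneg η
    rw [← div_eq_mul_inv, le_div_iff₀ (by positivity)]
    by_cases hηR : η ∈ Metric.closedBall 0 R₁
    · have h1 : ‖η‖ ≤ R₁ := by rwa [mem_closedBall_zero_iff] at hηR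
      calc _ ≤ M * (1 + R₁) ^ N := by
            gcongr
            exact hM η hηR
        _ ≤ _ := by
            have : 0 ≤ D * E ^ N := by positivity
            linarith
    · have hηO : η ∈ dualOrbit H ξ₀ := by
        obtain ⟨w, hw, s, hs, rfl⟩ := hη
        exact smul_mem_dualOrbit hO hw.2 hs
      -- Because `p` lies in `V` and `η` in the truncated cone, this `h` belongs to the outer set.
      obtain ⟨h, hh, hhη⟩ := exists_dualAct_eq hηO hpO
      have hhK : (⟨h, hh⟩ : H) ∈ K := mem_Ko_of_dualAct ⟨hη, hηR⟩ (by rw [hhη]; exact hpV)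
      have ht := opNorm_nonneg h
      have hn := opNorm_nonneg h⁻¹
      have h1 : ‖η‖ ≤ opNorm h⁻¹ * ‖p‖ := by
        have := norm_dualAct_le h⁻¹ p
        rwa [← hhη, dualAct_inv_dualAct, hhη] at this
      have h2 : (1 + ‖η‖) * opNorm h ^ m ≤ E := by
        calc _ ≤ ((1 + ‖p‖) * (1 + opNorm h⁻¹)) * opNorm h ^ m :=
              mul_le_mul_of_nonneg_right (by nlinarith) (pow_nonneg ht _)
          _ = (1 + ‖p‖) * ((1 + opNorm h⁻¹) * opNorm h ^ m) := by ring
          _ ≤ _ := mul_le_mul_of_nonneg_left (hKT' _ hhK).2 (by positivity)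
      calc _ ≤ D * opNorm h ^ (m * N) * (1 + ‖η‖) ^ N :=
            mul_le_mul_of_nonneg_right (hDK _ hhK η hhη) (by positivity)
        _ = D * ((1 + ‖η‖) * opNorm h ^ m) ^ N := by rw [mul_pow, pow_mul]; ring
        _ ≤ D * E ^ N := by gcongr
        _ ≤ _ := by
            have : 0 ≤ M * (1 + R₁) ^ N := by positivity
            linarith

end Converse

end WaveletWF

/-! ### The equivalence -/

theorem mainTheorem3 {d : ℕ} (H : Subgroup (GL (Fin d) ℝ))
    (hH : IsClosed (H : Set (GL (Fin d) ℝ)))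
    [MeasurableSpace H] [BorelSpace H] (μ : Measure H) [μ.IsHaarMeasure]
    (ξ₀ : WaveletWF.Rd d) (O : Set (WaveletWF.Rd d)) (hO : O = WaveletWF.dualOrbit H ξ₀)
    (hOopen : IsOpen O) (hstab : IsCompact (WaveletWF.dualStabilizer H ξ₀))
    (V : ℕ → Set (WaveletWF.Rd d)) (hV : ∀ n, WaveletWF.CompactlyInside (V n) O)
    (hVanti : Antitone V)
    (ξ₁ : WaveletWF.Sph d) (hξ₁ : (ξ₁ : WaveletWF.Rd d) ∈ O)
    (hcone : WaveletWF.WeakConeApprox H V ξ₁)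
    (hnorm : ∃ n, WaveletWF.InverseNormEstimate H (V n) ξ₁)
    (ψ : ℕ → 𝓢(WaveletWF.Rd d, ℂ)) (hψ : ∀ n, WaveletWF.Admissible H μ O (ψ n))
    (hψV : ∀ n, tsupport (𝓕 (ψ n) : 𝓢(WaveletWF.Rd d, ℂ)) ⊆ V n) :
    ∃ n₀ : ℕ, ∀ (u : 𝓢'(WaveletWF.Rd d, ℂ)) (x : WaveletWF.Rd d) (ξ : WaveletWF.Sph d),
      (ξ : WaveletWF.Rd d) ∈ O →
      List.TFAE [
        WaveletWF.IsRegularDirectedPoint u x ξ,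
        ∃ W : Set (WaveletWF.Sph d), IsOpen W ∧ ξ ∈ W ∧ ∃ R : ℝ, 0 < R ∧ ∃ U ∈ 𝓝 x, ∃ n₁ : ℕ,
          ∀ n ≥ n₁, WaveletWF.RapidDecayOn (ψ n) u U (WaveletWF.Ko H W (V n) R),
        ∃ n ≥ n₀, ∃ U ∈ 𝓝 x, ∃ R : ℝ, 0 < R ∧ ∃ W : Set (WaveletWF.Sph d), IsOpen W ∧ ξ ∈ W ∧
          WaveletWF.RapidDecayOn (ψ n) u U (WaveletWF.Ko H W (V n) R)] := by
  subst hO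
  obtain ⟨n₀, hn₀⟩ := hnorm
  have h0 : (0 : WaveletWF.Rd d) ∉ WaveletWF.dualOrbit H ξ₀ :=
    WaveletWF.zero_notMem_dualOrbit hξ₁ (ne_zero_of_mem_unit_sphere ξ₁)
  -- The index from the inverse norm estimate works for all `ξ` simultaneously: transport along the
  -- orbit changes the neighborhood and radius, never the index.
  refine ⟨n₀, fun u x ξ hξ => ?_⟩
  obtain ⟨W₀, hW₀, hξW₀, R₀, -, hT⟩ := WaveletWF.exists_tame_Ko
    ((hV n₀).2.2.1.isBounded.subset subset_closure) hξ₁ hξ hn₀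
  tfae_have 1 → 2 := WaveletWF.exists_rapidDecayOn_of_isRegularDirectedPoint hVanti
    (fun n => WaveletWF.exists_pos_le_norm_of_closure_subset (hV n).2.2.2 h0)
    (hcone.transport hξ₁ hξ) hW₀ hξW₀ hT ψ hψV u x
  tfae_have 2 → 3 := by
    rintro ⟨W, hW, hξW, R, hR, U, hU, n₁, h⟩
    exact ⟨max n₀ n₁, le_max_left _ _, U, hU, R, hR, W, hW, hξW, h _ (le_max_right _ _)⟩
  tfae_have 3 → 1 := by
    rintro ⟨n, hn, U, hU, R, hR, W, hW, hξW, h⟩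
    -- The target `p` is `gᵀ ξ₁`; it lies in `V n` because it belongs to the support of the Fourier
    -- transform of `ψ n`.
    obtain ⟨g, hg, hgψ⟩ := (hψ n).exists_fourier_ne_zero hξ₁
    exact WaveletWF.isRegularDirectedPoint_of_rapidDecayOn hOopen hξ hW₀ hξW₀
      (hT.mono (WaveletWF.Ko_mono subset_rfl (hVanti hn) le_rfl)) hW hξW hR hU
      (WaveletWF.dualAct_mem_dualOrbit hg hξ₁)
      (hψV n (subset_tsupport _ hgψ)) hgψ h
  tfae_finish
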